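/- Let $n\ge 1$, let $\Omega\subset\mathbb R^n$ be a bounded open set, $\Omega_e=\mathbb R^n\setminus\overline\Omega$, let $W\subset\Omega_e$ be a nonempty open set, $0<s<1$ and $1<p<\infty$. Let $[u]_{W^{s,p}(\mathbb R^n)}=\bigl(\int_{\mathbb R^{2n}}\frac{|u(x)-u(y)|^p}{|x-y|^{n+sp}}\,dx\,dy\bigr)^{1/p}$, let $W^{s,p}(\mathbb R^n)$ be the space of $u\in L^p(\mathbb R^n)$ with $[u]_{W^{s,p}(\mathbb R^n)}<\infty$, with norm $(\|u\|_{L^p}^p+[u]_{W^{s,p}(\mathbb R^n)}^p)^{1/p}$, and let $\widetilde W^{s,p}(\Omega)$ be the closure of $C_c^\infty(\Omega)$ in $W^{s,p}(\mathbb R^n)$. Put $d_su(x,y)=\frac{u(x)-u(y)}{|x-y|^s}$. For $j=1,2$ let $\sigma_j\colon\mathbb R^n\times\mathbb R^n\to\mathbb R$ be measurable and such that (a) there is $\lambda_j>0$ with $\lambda_j\le\sigma_j(x,y)\le\lambda_j^{-1}$ for all $x,y\in\mathbb R^n$; (b) for every $x_0\in W$ the family $(\sigma_j(x,\cdot)\colon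 W\to\mathbb R)_{x\in\mathbb R^n}$ is equicontinuous at $x_0$ and the function $\sigma_j(\cdot,x_0)$ is continuous on $W$. For $f\in W^{s,p}(\mathbb R^n)$ let $u_f^{(j)}\in W^{s,p}(\mathbb R^n)$ be the unique weak solution of $\operatorname{div}_s(\sigma_j|d_su|^{p-2}d_su)=0$ in $\Omega$, $u=f$ in $\Omega_e$, that is, $u_f^{(j)}-f\in\widetilde W^{s,p}(\Omega)$ and $$\int_{\mathbb R^{2n}}\sigma_j\,|d_su_f^{(j)}|^{p-2}d_su_f^{(j)}\,d_s\varphi\,\frac{dx\,dy}{|x-y|^n}=0\qquad\text{for all }\varphi\in C_c^\infty(\Omega),$$ and define the Dirichlet-to-Neumann map by $$\langle\Lambda_{\sigma_j}f,g\rangle=\int_{\mathbb R^{2n}}\sigma_j\,|d_su_f^{(j)}|^{p-2}d_su_f^{(j)}\,d_sg\,\frac{dx\,dy}{|x-y|^n},\qquad g\in W^{s,p}(\mathbb R^n).$$ Set $\Sigma_j(x)=\sigma_j(x,x)$ for $x\in\mathbb R^n$. If $\Lambda_{\sigma_1}f|_W=\Lambda_{\sigma_2}f|_W$ for all $f\in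 C_c^\infty(W)$, that is, $\langle\Lambda_{\sigma_1}f,g\rangle=\langle\Lambda_{\sigma_2}f,g\rangle$ for all $f,g\in C_c^\infty(W)$, and if $\Sigma_1$ and $\Sigma_2$ are real-analytic on $\mathbb R^n$, then $\Sigma_1=\Sigma_2$ in $\mathbb R^n$. -/

import Mathlib

open MeasureTheory Topology
open scoped ENNReal

noncomputable section

namespace FracPLap

/-- The Euclidean space `ℝⁿ`. -/
abbrev Rn (n : ℕ) : Type := EuclideanSpace ℝ (Fin n)

variable {n : ℕ}

/-- `φ ∈ C_c^∞(U)`, extended by zero: smooth on `ℝⁿ` with compact support contained in `U`. -/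
structure IsTestFun (U : Set (Rn n)) (φ : Rn n → ℝ) : Prop where
  smooth : ContDiff ℝ ((⊤ : ℕ∞) : WithTop ℕ∞) φ
  compact : HasCompactSupport φ
  support : tsupport φ ⊆ U

/-- The exterior `Ω_e = ℝⁿ \ closure Ω`. -/
def exterior (Ω : Set (Rn n)) : Set (Rn n) := (closure Ω)ᶜ

/-- The Gagliardo seminorm `[u]_{W^{s,p}(ℝⁿ)}`, with values in `[0, ∞]`. -/
def gagliardo (s p : ℝ) (u : Rn n → ℝ) : ℝ≥0∞ :=
  (∫⁻ z : Rn n × Rn n,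
    ENNReal.ofReal (|u z.1 - u z.2| ^ p / ‖z.1 - z.2‖ ^ ((n : ℝ) + s * p))) ^ (1 / p)

/-- The norm `‖u‖_{W^{s,p}(ℝⁿ)} = (‖u‖_{L^p}^p + [u]^p)^{1/p}`, with values in `[0, ∞]`. -/
def sobolevNorm (s p : ℝ) (u : Rn n → ℝ) : ℝ≥0∞ :=
  (eLpNorm u (ENNReal.ofReal p) volume ^ p + gagliardo s p u ^ p) ^ (1 / p)

/-- `u ∈ W^{s,p}(ℝⁿ)`, where the function `u` stands for its class modulo a.e. equality. -/
structure MemSobolev (s p : ℝ) (u : Rn n → ℝ) : Prop where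
  memLp : MemLp u (ENNReal.ofReal p) volume
  gagliardo_lt_top : gagliardo s p u < ∞

/-- `u` belongs to the closure of `C_c^∞(Ω)` in `W^{s,p}(ℝⁿ)`. -/
structure MemSobolevTilde (s p : ℝ) (Ω : Set (Rn n)) (u : Rn n → ℝ) : Prop where
  memSobolev : MemSobolev s p u
  approx : ∀ ε : ℝ≥0∞, 0 < ε →
    ∃ φ : Rn n → ℝ, IsTestFun Ω φ ∧ sobolevNorm s p (fun x => u x - φ x) < ε

/-- The fractional `s`-gradient `d_s u (x, y) = (u x - u y) / |x - y|^s`. -/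
def fracGrad (s : ℝ) (u : Rn n → ℝ) (x y : Rn n) : ℝ :=
  (u x - u y) / ‖x - y‖ ^ s

/-- The fractional `s`-divergence `⟨div_s F, φ⟩ = ∫ F d_s φ dx dy / |x - y|ⁿ`. -/
def fracDiv (s : ℝ) (F : Rn n → Rn n → ℝ) (φ : Rn n → ℝ) : ℝ :=
  ∫ z : Rn n × Rn n, F z.1 z.2 * fracGrad s φ z.1 z.2 / ‖z.1 - z.2‖ ^ n

/-- The weighted fractional `p`-Laplacian, `⟨div_s (σ |d_s u|^{p-2} d_s u), φ⟩`. -/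
def weightedPLap (s p : ℝ) (σ : Rn n → Rn n → ℝ) (u φ : Rn n → ℝ) : ℝ :=
  fracDiv s (fun x y => σ x y * |fracGrad s u x y| ^ (p - 2) * fracGrad s u x y) φ

/-- Uniform ellipticity: `l ≤ σ(x, y) ≤ l⁻¹` for all `x, y`, with some constant `l > 0`. -/
def UniformlyElliptic (σ : Rn n → Rn n → ℝ) : Prop :=
  ∃ l : ℝ, 0 < l ∧ ∀ x y, l ≤ σ x y ∧ σ x y ≤ l⁻¹

/-- `u ∈ W^{s,p}(ℝⁿ)` is a weak solution of `div_s (σ |d_s u|^{p-2} d_s u) = 0` in `Ω`,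
`u = f` in `Ω_e`: it solves the equation in the sense of distributions in `Ω`, and `u - f`
lies in the closure of `C_c^∞(Ω)` in `W^{s,p}(ℝⁿ)`. -/
structure IsWeakSolution (s p : ℝ) (Ω : Set (Rn n)) (σ : Rn n → Rn n → ℝ)
    (f u : Rn n → ℝ) : Prop where
  memSobolev : MemSobolev s p u
  equation : ∀ φ : Rn n → ℝ, IsTestFun Ω φ → weightedPLap s p σ u φ = 0
  exterior_data : MemSobolevTilde s p Ω (fun x => u x - f x)

open Classical in
/-- The weak solution `u_f` with exterior data `f`. For `f ∈ W^{s,p}(ℝⁿ)` and measurable uniformly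
elliptic `σ` it exists and is unique up to a.e. equality (the default `0` is then not used). -/
def solution (s p : ℝ) (Ω : Set (Rn n)) (σ : Rn n → Rn n → ℝ) (f : Rn n → ℝ) : Rn n → ℝ :=
  if h : ∃ u, IsWeakSolution s p Ω σ f u then h.choose else 0

/-- The Dirichlet-to-Neumann map, `⟨Λ_σ f, g⟩ = ∫ σ |d_s u_f|^{p-2} d_s u_f d_s g dx dy / |x - y|ⁿ`,
on representatives `f, g ∈ W^{s,p}(ℝⁿ)` of exterior data. -/
def dnMap (s p : ℝ) (Ω : Set (Rn n)) (σ : Rn n → Rn n → ℝ) (f g : Rn n → ℝ) : ℝ :=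
  weightedPLap s p σ (solution s p Ω σ f) g

/-- The conditions on a coefficient: (Lebesgue) measurable, uniformly elliptic, and at every
`x₀ ∈ W` the family `(σ(x, ·) : W → ℝ)`, `x ∈ ℝⁿ`, is equicontinuous and `σ(·, x₀) ∈ C(W)`. -/
structure AdmissibleCoeff (W : Set (Rn n)) (σ : Rn n → Rn n → ℝ) : Prop where
  aemeasurable : AEMeasurable (fun z : Rn n × Rn n => σ z.1 z.2) volume
  elliptic : UniformlyElliptic σ
  equicontinuous : ∀ x₀ ∈ W, EquicontinuousWithinAt (fun x y => σ x y) W x₀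
  continuousOn : ∀ x₀ ∈ W, ContinuousOn (fun x => σ x x₀) W

end FracPLap

end

noncomputable section

namespace FracPLap

/-! The diagonal values on `W` are recovered by testing the Dirichlet-to-Neumann map on data
concentrated at a point, with `g = f`. Testing the weak equation with `u_f - f` shows that `⟨Λ_σ f,
f⟩` is the `σ`-weighted energy of `u_f`. Since `u_f = f` outside `Ω`, this is at least the weighted
energy of `f` restricted to `B × B` for any measurable `B` disjoint from `Ω`. Young's inequality in
the same identity bounds it above by the total weighted energy of `f`. This two-sided bound is
`dnMap_self_bounds`; no further information on `u_f` is needed.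

It remains to find test functions whose Gagliardo energy lies almost entirely in `B × B` for a small
ball `B` around `x₀ ∈ W` (`exists_concentrated`). The energy outside `B × B` is controlled by the
`L^p` norm, because the singular kernel is integrable away from the diagonal (`exists_tail_le`). The
`L^p` norm to the power `p` is at most `C R^{sp}` times the energy when the support lies in a ball
of radius `R` (`exists_poincare`). Letting `R` shrink with `B` fixed makes the tail negligible. The
hypotheses on `σ` make it nearly constant on `B × B`, so comparing the two sandwiches gives `σ₁(x₀,
x₀) ≤ σ₂(x₀, x₀)` (`diagonal_le_of_dnMap_le`) and, by symmetry, equality on `W`. The identity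
theorem for analytic functions does the rest.

The bounds apply to `solution` only once a weak solution exists. Weighted gradients embed the
problem in `L^p(ℝⁿ × ℝⁿ)`, where uniform convexity yields an element of least norm in a translate of
the closure of the test gradients; its Euler-Lagrange equation is the weak equation, and Poincaré
shows that limits of test gradients are again gradients (`exists_isWeakSolution`). -/

/-! ### The function `|x|^{p-2} x` -/

/-- The monotone power `|x|^{p-2} x`, a subgradient of `|x|^p / p`. -/
def dualPow (p x : ℝ) : ℝ := |x| ^ (p - 2) * x

lemma dualPow_mul_self {p : ℝ} (hp : 1 < p) (x : ℝ) : dualPow p x * x = |x| ^ p := by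
  unfold dualPow
  rcases eq_or_ne x 0 with rfl | hx
  · simp [Real.zero_rpow (by linarith : p ≠ 0)]
  · have h : 0 < |x| := abs_pos.2 hx
    rw [mul_assoc, ← pow_two, ← sq_abs, ← Real.rpow_natCast, ← Real.rpow_add h]
    norm_num

lemma abs_dualPow {p : ℝ} (hp : 1 < p) (x : ℝ) : |dualPow p x| = |x| ^ (p - 1) := by
  unfold dualPow
  rcases eq_or_ne x 0 with rfl | hx
  · simp [Real.zero_rpow (by linarith : p - 1 ≠ 0)]
  · have h : 0 < |x| := abs_pos.2 hx
    rw [abs_mul, abs_of_nonneg (Real.rpow_nonneg h.le _), ← Real.rpow_add_one h.ne']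
    ring_nf

lemma continuous_dualPow {p : ℝ} (hp : 1 < p) : Continuous (dualPow p) := by
  rw [continuous_iff_continuousAt]
  intro x
  rcases eq_or_ne x 0 with rfl | hx
  · have h0 : dualPow p 0 = 0 := by simp [dualPow]
    rw [ContinuousAt, h0]
    refine squeeze_zero_norm (a := fun x => |x| ^ (p - 1))
      (fun y => by rw [Real.norm_eq_abs, abs_dualPow hp]) ?_
    have : Continuous fun x : ℝ => |x| ^ (p - 1) :=
      continuous_abs.rpow_const fun _ => Or.inr (by linarith)
    simpa [Real.zero_rpow (by linarith : p - 1 ≠ 0)] using this.tendsto 0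
  · exact ((continuous_abs.continuousAt).rpow_const (Or.inl (abs_ne_zero.2 hx))).mul
      continuousAt_id

/-- Young's inequality for `|x|^{p-1}` and `|y|` with exponents `p/(p-1)` and `p`. It takes the
place of Hölder's inequality throughout. -/
lemma abs_dualPow_mul_le {p : ℝ} (hp : 1 < p) (x y : ℝ) :
    |dualPow p x * y| ≤ (1 - 1 / p) * |x| ^ p + 1 / p * |y| ^ p := by
  have hq := (Real.HolderConjugate.conjExponent hp).symm
  have h := Real.young_inequality (|x| ^ (p - 1)) |y| hq
  rw [abs_abs, abs_of_nonneg (Real.rpow_nonneg (abs_nonneg x) _),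
    ← Real.rpow_mul (abs_nonneg x)] at h
  have h1 : (p - 1) * p.conjExponent = p := by
    rw [Real.conjExponent]; field_simp [(by linarith : p - 1 ≠ 0)]
  rw [h1] at h
  rw [abs_mul, abs_dualPow hp]
  refine h.trans (le_of_eq ?_)
  have h2 : 1 / p.conjExponent = 1 - 1 / p := by
    rw [Real.conjExponent]
    have : p - 1 ≠ 0 := by linarith
    have : p ≠ 0 := by linarith
    field_simp
  rw [← h2]
  ring

/-- Convexity: the tangent to `|·|^p` at `y` lies below the graph at `x`. It follows from Young's
inequality without differentiating. -/
lemma abs_rpow_le_add_dualPow {p : ℝ} (hp : 1 < p) (x y : ℝ) :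
    |y| ^ p ≤ |x| ^ p + p * (dualPow p y * (y - x)) := by
  have h := (le_abs_self _).trans (abs_dualPow_mul_le hp y x)
  have hp0 : 0 < p := by linarith
  rw [mul_sub, dualPow_mul_self hp]
  have h' := mul_le_mul_of_nonneg_left h hp0.le
  have : p * ((1 - 1 / p) * |y| ^ p + 1 / p * |x| ^ p) = (p - 1) * |y| ^ p + |x| ^ p := by
    field_simp
  linarith

/-! ### Uniform convexity of the `p`-th power -/

/-- If `|a| = |b|`, then `a = -b ≠ 0` and the midpoint vanishes; otherwise strict convexity of `t ↦
t^p` on `[0, ∞)` applies to `|a|` and `|b|`. -/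
lemma abs_midpoint_rpow_lt {p : ℝ} (hp : 1 < p) {a b : ℝ} (hab : a ≠ b) :
    |(a + b) / 2| ^ p < (|a| ^ p + |b| ^ p) / 2 := by
  have hp0 : 0 < p := by linarith
  by_cases h : |a| = |b|
  · rcases abs_eq_abs.1 h with h' | h'
    · exact absurd h' hab
    · have hb : b ≠ 0 := by rintro rfl; exact hab (by simpa using h')
      have : 0 < |b| ^ p := Real.rpow_pos_of_pos (abs_pos.2 hb) p
      rw [h, h']
      simp [Real.zero_rpow hp0.ne', this]
  · have h1 := (strictConvexOn_rpow hp).2 (abs_nonneg a) (abs_nonneg b) h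
      (show (0 : ℝ) < 1 / 2 by norm_num) (show (0 : ℝ) < 1 / 2 by norm_num) (by norm_num)
    have h2 : |(a + b) / 2| ^ p ≤ (1 / 2 * |a| + 1 / 2 * |b|) ^ p := by
      refine Real.rpow_le_rpow (abs_nonneg _) ?_ hp0.le
      rw [abs_div, abs_two]
      linarith [abs_add_le a b]
    simp only [smul_eq_mul] at h1
    linarith

lemma abs_midpoint_rpow_le {p : ℝ} (hp : 1 < p) (a b : ℝ) :
    |(a + b) / 2| ^ p ≤ (|a| ^ p + |b| ^ p) / 2 := by
  rcases eq_or_ne a b with rfl | h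
  · simp
  · exact (abs_midpoint_rpow_lt hp h).le

/-- Homogeneity reduces the claim to the unit sphere of `ℝ × ℝ`, where compactness and strict
convexity give it. This substitutes for Clarkson's inequalities and treats all `1 < p < ∞` at once.
-/
lemma exists_abs_sub_rpow_le {p : ℝ} (hp : 1 < p) {ε : ℝ} (hε : 0 < ε) :
    ∃ C : ℝ, 0 ≤ C ∧ ∀ a b : ℝ, |a - b| ^ p ≤ ε * (|a| ^ p + |b| ^ p) +
      C * ((|a| ^ p + |b| ^ p) / 2 - |(a + b) / 2| ^ p) := by
  have hp0 : 0 < p := by linarith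
  have hc : Continuous fun x : ℝ => |x| ^ p := continuous_abs.rpow_const fun _ => Or.inr hp0.le
  set D : ℝ × ℝ → ℝ := fun z => (|z.1| ^ p + |z.2| ^ p) / 2 - |(z.1 + z.2) / 2| ^ p with hD
  have hDc : Continuous D :=
    (((hc.comp continuous_fst).add (hc.comp continuous_snd)).div_const 2).sub
      (hc.comp ((continuous_fst.add continuous_snd).div_const 2))
  have hD0 : ∀ z, 0 ≤ D z := fun z => sub_nonneg.2 (abs_midpoint_rpow_le hp z.1 z.2)
  -- The compact part of the sphere where the `ε` term may fail to suffice. Points of `K` have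
  -- distinct coordinates, so the convexity deficit `D` has a positive minimum there.
  set K : Set (ℝ × ℝ) := Metric.sphere 0 1 ∩
    {z | ε * (|z.1| ^ p + |z.2| ^ p) ≤ |z.1 - z.2| ^ p} with hK
  have hKc : IsCompact K := (isCompact_sphere _ _).inter_right
    (isClosed_le (continuous_const.mul ((hc.comp continuous_fst).add (hc.comp continuous_snd)))
      (hc.comp (continuous_fst.sub continuous_snd)))
  have key : ∃ C : ℝ, 0 ≤ C ∧ ∀ z ∈ Metric.sphere (0 : ℝ × ℝ) 1,
      |z.1 - z.2| ^ p ≤ ε * (|z.1| ^ p + |z.2| ^ p) + C * D z := by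
    rcases K.eq_empty_or_nonempty with h | h
    · refine ⟨0, le_rfl, fun z hz => ?_⟩
      have : z ∉ K := by rw [h]; simp
      have h' := not_le.1 fun h' : ε * (|z.1| ^ p + |z.2| ^ p) ≤ |z.1 - z.2| ^ p => this ⟨hz, h'⟩
      linarith
    · obtain ⟨z₀, hz₀, hmin⟩ := hKc.exists_isMinOn h hDc.continuousOn
      have hpos : 0 < D z₀ := by
        refine sub_pos.2 (abs_midpoint_rpow_lt hp fun hab => ?_)
        have h1 := hz₀.2
        simp only [Set.mem_ofPred_eq, hab, sub_self, abs_zero, Real.zero_rpow hp0.ne'] at h1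
        have h2 : |z₀.2| ^ p ≤ 0 := by
          have := Real.rpow_nonneg (abs_nonneg z₀.2) p
          nlinarith
        have h3 : z₀.2 = 0 := by
          by_contra h'
          exact absurd (Real.rpow_pos_of_pos (abs_pos.2 h') p) (not_lt.2 h2)
        have h4 := hz₀.1
        rw [mem_sphere_zero_iff_norm, Prod.norm_def, hab, h3] at h4
        simp at h4
      -- On the sphere of the sup norm `|a - b| ≤ 2`, so this constant times `D z ≥ D z₀` dominates
      -- `|a - b|^p` on `K`.
      refine ⟨2 ^ p / D z₀, by positivity, fun z hz => ?_⟩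
      by_cases hzK : z ∈ K
      · have h1 : |z.1 - z.2| ^ p ≤ 2 ^ p := by
          refine Real.rpow_le_rpow (abs_nonneg _) ?_ hp0.le
          rw [mem_sphere_zero_iff_norm] at hz
          have h1 := norm_fst_le z
          have h2 := norm_snd_le z
          rw [Real.norm_eq_abs, hz] at h1 h2
          linarith [abs_sub z.1 z.2]
        have h2 : 2 ^ p ≤ 2 ^ p / D z₀ * D z := by
          rw [div_mul_eq_mul_div, le_div_iff₀ hpos]
          exact mul_le_mul_of_nonneg_left (hmin hzK) (by positivity)
        have h3 : 0 ≤ ε * (|z.1| ^ p + |z.2| ^ p) := by positivity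
        linarith
      · have h' := not_le.1 fun h' : ε * (|z.1| ^ p + |z.2| ^ p) ≤ |z.1 - z.2| ^ p => hzK ⟨hz, h'⟩
        have h3 : 0 ≤ 2 ^ p / D z₀ * D z := mul_nonneg (by positivity) (hD0 z)
        linarith
  obtain ⟨C, hC, h⟩ := key
  refine ⟨C, hC, fun a b => ?_⟩
  rcases eq_or_ne ((a, b) : ℝ × ℝ) 0 with h0 | h0
  · simp only [Prod.mk_eq_zero] at h0
    simp [h0.1, h0.2, Real.zero_rpow hp0.ne']
  · set t := ‖((a, b) : ℝ × ℝ)‖ with ht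
    have htp : 0 < t := norm_pos_iff.2 h0
    have h1 := h (t⁻¹ • (a, b)) (by
      rw [mem_sphere_zero_iff_norm, norm_smul, norm_inv, norm_norm, inv_mul_cancel₀ htp.ne'])
    have hs : ∀ x : ℝ, |t⁻¹ * x| ^ p = (t ^ p)⁻¹ * |x| ^ p := fun x => by
      rw [abs_mul, abs_inv, abs_of_pos htp, Real.mul_rpow (by positivity) (abs_nonneg x),
        Real.inv_rpow htp.le]
    simp only [hD, Prod.smul_mk, smul_eq_mul] at h1
    rw [← mul_sub, ← mul_add, mul_div_assoc, hs, hs, hs, hs] at h1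
    have h2 := mul_le_mul_of_nonneg_left h1 (Real.rpow_pos_of_pos htp p).le
    have htp' : t ^ p ≠ 0 := (Real.rpow_pos_of_pos htp p).ne'
    have e1 : t ^ p * ((t ^ p)⁻¹ * |a - b| ^ p) = |a - b| ^ p := by field_simp
    have e2 : t ^ p * (ε * ((t ^ p)⁻¹ * |a| ^ p + (t ^ p)⁻¹ * |b| ^ p) +
      C * (((t ^ p)⁻¹ * |a| ^ p + (t ^ p)⁻¹ * |b| ^ p) / 2 - (t ^ p)⁻¹ * |(a + b) / 2| ^ p)) =
      ε * (|a| ^ p + |b| ^ p) + C * ((|a| ^ p + |b| ^ p) / 2 - |(a + b) / 2| ^ p) := by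
      field_simp
    rwa [e1, e2] at h2

/-- In a complete space with a uniformly convex `p`-th power of the norm, closed convex sets have
elements of least norm. -/
lemma exists_norm_le_of_uniformlyConvex {E : Type*} [NormedAddCommGroup E] [NormedSpace ℝ E]
    [CompleteSpace E] {p : ℝ} (hp : 1 < p)
    (hU : ∀ ε : ℝ, 0 < ε → ∃ C : ℝ, 0 ≤ C ∧ ∀ a b : E, ‖a - b‖ ^ p ≤ ε * (‖a‖ ^ p + ‖b‖ ^ p) +
      C * ((‖a‖ ^ p + ‖b‖ ^ p) / 2 - ‖(1 / 2 : ℝ) • a + (1 / 2 : ℝ) • b‖ ^ p))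
    {K : Set E} (hKc : IsClosed K) (hKx : Convex ℝ K) (hKn : K.Nonempty) :
    ∃ u ∈ K, ∀ w ∈ K, ‖u‖ ≤ ‖w‖ := by
  have hp0 : 0 < p := by linarith
  set d := sInf ((fun x : E => ‖x‖) '' K) with hd
  have hbdd : BddBelow ((fun x : E => ‖x‖) '' K) := ⟨0, by rintro _ ⟨x, -, rfl⟩; exact norm_nonneg x⟩
  have hdle : ∀ w ∈ K, d ≤ ‖w‖ := fun w hw => csInf_le hbdd ⟨w, hw, rfl⟩
  have hd0 : 0 ≤ d := le_csInf (hKn.image _) (by rintro _ ⟨x, -, rfl⟩; exact norm_nonneg x)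
  obtain ⟨a, -, hat, ham⟩ := exists_seq_tendsto_sInf (hKn.image fun x : E => ‖x‖) hbdd
  choose x hxK hxa using ham
  have hx : Filter.Tendsto (fun k => ‖x k‖ ^ p) Filter.atTop (𝓝 (d ^ p)) := by
    have h1 : Filter.Tendsto (fun k => ‖x k‖) Filter.atTop (𝓝 d) := by
      simpa only [hxa] using hat
    exact h1.rpow_const (Or.inr hp0.le)
  have hC : CauchySeq x := by
    rw [Metric.cauchySeq_iff']
    intro η hη
    have hM : 0 < d ^ p + 1 := by positivity
    have hηp : 0 < η ^ p := Real.rpow_pos_of_pos hη p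
    -- Midpoints stay in `K`, so their norm is at least `d` and the convexity deficit of a
    -- minimizing sequence tends to zero. With this parameter and `τ` below, the two terms are at
    -- most `η^p / 2` and `η^p / 4`; the added ones avoid division by zero.
    obtain ⟨C, hC, h⟩ := hU (η ^ p / (4 * (d ^ p + 1))) (by positivity)
    set τ := min 1 (η ^ p / (4 * (C + 1))) with hτ
    have hτ0 : 0 < τ := by positivity
    obtain ⟨N, hN⟩ := Filter.eventually_atTop.1 (hx.eventually (gt_mem_nhds
      (show d ^ p < d ^ p + τ by linarith)))
    refine ⟨N, fun k hk => ?_⟩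
    have h1 := hN k hk
    have h2 := hN N le_rfl
    have h3 := h (x k) (x N)
    have h4 : d ^ p ≤ ‖(1 / 2 : ℝ) • x k + (1 / 2 : ℝ) • x N‖ ^ p :=
      Real.rpow_le_rpow hd0 (hdle _ (hKx (hxK k) (hxK N) (by norm_num) (by norm_num)
        (by norm_num))) hp0.le
    have h5 : η ^ p / (4 * (d ^ p + 1)) * (‖x k‖ ^ p + ‖x N‖ ^ p) ≤ η ^ p / 2 := by
      calc _ ≤ η ^ p / (4 * (d ^ p + 1)) * (2 * (d ^ p + 1)) := by
            refine mul_le_mul_of_nonneg_left ?_ (by positivity)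
            linarith [min_le_left 1 (η ^ p / (4 * (C + 1)))]
        _ = η ^ p / 2 := by field_simp; norm_num
    have h6 : C * ((‖x k‖ ^ p + ‖x N‖ ^ p) / 2 - ‖(1 / 2 : ℝ) • x k + (1 / 2 : ℝ) • x N‖ ^ p) ≤
        η ^ p / 4 := by
      calc _ ≤ C * (η ^ p / (4 * (C + 1))) := by
            refine mul_le_mul_of_nonneg_left ?_ hC
            linarith [min_le_right 1 (η ^ p / (4 * (C + 1)))]
        _ ≤ (C + 1) * (η ^ p / (4 * (C + 1))) := by gcongr; linarith
        _ = η ^ p / 4 := by field_simp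
    rw [dist_eq_norm]
    exact (Real.rpow_lt_rpow_iff (norm_nonneg _) hη.le hp0).1 (by linarith)
  obtain ⟨u, hu⟩ := cauchySeq_tendsto_of_complete hC
  refine ⟨u, hKc.mem_of_tendsto hu (Filter.Eventually.of_forall hxK), fun w hw => ?_⟩
  refine le_trans (le_of_eq (tendsto_nhds_unique hu.norm ?_)) (hdle w hw)
  simpa only [hxa] using hat

/-! ### The pairing `∫ |a|^{p-2} a b` on `L^p` -/

section Pairing

variable {X : Type*} [MeasurableSpace X] {μ : Measure X} {p : ℝ}

lemma integrable_abs_rpow (hp : 1 < p) {a : X → ℝ} (ha : MemLp a (ENNReal.ofReal p) μ) :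
    Integrable (fun x => |a x| ^ p) μ := by
  have h := ha.integrable_norm_rpow (by simp; linarith) ENNReal.ofReal_ne_top
  rwa [ENNReal.toReal_ofReal (by linarith)] at h

lemma aestronglyMeasurable_dualPow_mul (hp : 1 < p) {a b : X → ℝ} (ha : AEStronglyMeasurable a μ)
    (hb : AEStronglyMeasurable b μ) :
    AEStronglyMeasurable (fun x => dualPow p (a x) * b x) μ :=
  ((continuous_dualPow hp).comp_aestronglyMeasurable ha).mul hb

lemma integrable_dualPow_mul (hp : 1 < p) {a b : X → ℝ} (ha : MemLp a (ENNReal.ofReal p) μ)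
    (hb : MemLp b (ENNReal.ofReal p) μ) : Integrable (fun x => dualPow p (a x) * b x) μ :=
  (((integrable_abs_rpow hp ha).const_mul (1 - 1 / p)).add
    ((integrable_abs_rpow hp hb).const_mul (1 / p))).mono'
    (aestronglyMeasurable_dualPow_mul hp ha.1 hb.1)
    (Filter.Eventually.of_forall fun x => abs_dualPow_mul_le hp (a x) (b x))

lemma integral_dualPow_mul_le (hp : 1 < p) {a b : X → ℝ} (ha : MemLp a (ENNReal.ofReal p) μ)
    (hb : MemLp b (ENNReal.ofReal p) μ) :
    ∫ x, dualPow p (a x) * b x ∂μ ≤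
      (1 - 1 / p) * ∫ x, |a x| ^ p ∂μ + 1 / p * ∫ x, |b x| ^ p ∂μ := by
  rw [← integral_const_mul, ← integral_const_mul, ← integral_add
    ((integrable_abs_rpow hp ha).const_mul _) ((integrable_abs_rpow hp hb).const_mul _)]
  exact integral_mono (integrable_dualPow_mul hp ha hb)
    (((integrable_abs_rpow hp ha).const_mul _).add ((integrable_abs_rpow hp hb).const_mul _))
    fun x => (le_abs_self _).trans (abs_dualPow_mul_le hp (a x) (b x))

lemma eLpNorm_rpow_eq (hp : 1 < p) (a : X → ℝ) :
    eLpNorm a (ENNReal.ofReal p) μ ^ p = ∫⁻ x, ENNReal.ofReal (|a x| ^ p) ∂μ := by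
  have hp0 : 0 < p := by linarith
  rw [eLpNorm_eq_lintegral_rpow_enorm_toReal (by simpa using hp0) ENNReal.ofReal_ne_top,
    ENNReal.toReal_ofReal hp0.le, ← ENNReal.rpow_mul, one_div_mul_cancel hp0.ne', ENNReal.rpow_one]
  refine lintegral_congr fun x => ?_
  rw [← ENNReal.ofReal_rpow_of_nonneg (abs_nonneg _) hp0.le, Real.enorm_eq_ofReal_abs]

lemma integral_abs_rpow_eq_toReal (hp : 1 < p) {a : X → ℝ} (ha : AEStronglyMeasurable a μ) :
    ∫ x, |a x| ^ p ∂μ = (eLpNorm a (ENNReal.ofReal p) μ).toReal ^ p := by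
  have hp0 : 0 < p := by linarith
  rw [ENNReal.toReal_rpow, eLpNorm_rpow_eq hp, integral_eq_lintegral_of_nonneg_ae]
  · exact Filter.Eventually.of_forall fun x => Real.rpow_nonneg (abs_nonneg _) _
  · exact (continuous_abs.rpow_const fun _ => Or.inr hp0.le : Continuous fun x : ℝ => |x| ^ p)
      |>.comp_aestronglyMeasurable ha

/-- The pairing is continuous in its second argument. -/
lemma integral_dualPow_mul_eq_zero_of_approx (hp : 1 < p) {a b : X → ℝ}
    (ha : MemLp a (ENNReal.ofReal p) μ) (hb : MemLp b (ENNReal.ofReal p) μ)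
    (h : ∀ ε : ℝ, 0 < ε → ∃ c : X → ℝ, MemLp c (ENNReal.ofReal p) μ ∧
      ∫ x, dualPow p (a x) * c x ∂μ = 0 ∧ ∫ x, |b x - c x| ^ p ∂μ ≤ ε) :
    ∫ x, dualPow p (a x) * b x ∂μ = 0 := by
  have hp0 : 0 < p := by linarith
  set A := ∫ x, |a x| ^ p ∂μ with hA
  have hA0 : 0 ≤ A := integral_nonneg fun x => Real.rpow_nonneg (abs_nonneg _) _
  have key : ∀ b : X → ℝ, MemLp b (ENNReal.ofReal p) μ → (∀ ε : ℝ, 0 < ε →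
      ∃ c : X → ℝ, MemLp c (ENNReal.ofReal p) μ ∧
      ∫ x, dualPow p (a x) * c x ∂μ = 0 ∧ ∫ x, |b x - c x| ^ p ∂μ ≤ ε) →
      ∫ x, dualPow p (a x) * b x ∂μ ≤ 0 := by
    intro b hb h
    refine le_of_forall_pos_le_add fun δ hδ => ?_
    rw [zero_add]
    -- scale the difference by a large factor `t` and use Young's inequality
    set t : ℝ := (A + 1) / δ with ht
    have ht0 : 0 < t := by positivity
    obtain ⟨c, hc, hc0, hbc⟩ := h ((t ^ p)⁻¹) (by positivity)
    have hd : MemLp (fun x => t * (b x - c x)) (ENNReal.ofReal p) μ := (hb.sub hc).const_mul t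
    have h1 := integral_dualPow_mul_le hp ha hd
    have h2 : ∫ x, dualPow p (a x) * (t * (b x - c x)) ∂μ =
        t * ∫ x, dualPow p (a x) * b x ∂μ := by
      have : ∀ x, dualPow p (a x) * (t * (b x - c x)) =
        t * (dualPow p (a x) * b x - dualPow p (a x) * c x) := fun x => by ring
      simp_rw [this]
      rw [integral_const_mul, integral_sub (integrable_dualPow_mul hp ha hb)
        (integrable_dualPow_mul hp ha hc), hc0, sub_zero]
    have h3 : ∫ x, |t * (b x - c x)| ^ p ∂μ ≤ 1 := by
      have : ∀ x, |t * (b x - c x)| ^ p = t ^ p * |b x - c x| ^ p := fun x => by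
        rw [abs_mul, abs_of_pos ht0, Real.mul_rpow ht0.le (abs_nonneg _)]
      simp_rw [this]
      rw [integral_const_mul]
      calc _ ≤ t ^ p * (t ^ p)⁻¹ := by gcongr
        _ = 1 := mul_inv_cancel₀ (by positivity)
    rw [h2] at h1
    have hp1 : 1 / p ≤ 1 := by rw [div_le_one hp0]; exact hp.le
    have hp2 : 0 ≤ 1 / p := by positivity
    have h4 : t * ∫ x, dualPow p (a x) * b x ∂μ ≤ A + 1 := by
      refine h1.trans ?_
      have := integral_nonneg (μ := μ) (f := fun x => |t * (b x - c x)| ^ p)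
        fun x => Real.rpow_nonneg (abs_nonneg _) _
      nlinarith
    have h5 : t * δ = A + 1 := by rw [ht]; field_simp
    rw [← h5] at h4
    exact le_of_mul_le_mul_left h4 ht0
  refine le_antisymm (key b hb h) ?_
  have := key (fun x => -b x) hb.neg fun ε hε => by
    obtain ⟨c, hc, hc0, hbc⟩ := h ε hε
    refine ⟨fun x => -c x, hc.neg, by simp [integral_neg, hc0], ?_⟩
    refine le_trans (le_of_eq (integral_congr_ae (Filter.Eventually.of_forall fun x => ?_))) hbc
    simp only
    rw [← abs_neg]
    ring_nf
  simp only [mul_neg, integral_neg] at this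
  linarith

lemma Lp_norm_rpow_eq (hp : 1 < p) (a : Lp ℝ (ENNReal.ofReal p) μ) :
    ‖a‖ ^ p = ∫ x, |a x| ^ p ∂μ := by
  rw [Lp.norm_def, integral_abs_rpow_eq_toReal hp (Lp.aestronglyMeasurable a)]

/-- The scalar inequality involves only `p`-th powers, so it integrates pointwise with the same
constant. -/
lemma Lp_uniformlyConvex [Fact (1 ≤ ENNReal.ofReal p)] (hp : 1 < p) {ε : ℝ} (hε : 0 < ε) :
    ∃ C : ℝ, 0 ≤ C ∧ ∀ a b : Lp ℝ (ENNReal.ofReal p) μ,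
      ‖a - b‖ ^ p ≤ ε * (‖a‖ ^ p + ‖b‖ ^ p) +
      C * ((‖a‖ ^ p + ‖b‖ ^ p) / 2 - ‖(1 / 2 : ℝ) • a + (1 / 2 : ℝ) • b‖ ^ p) := by
  obtain ⟨C, hC, h⟩ := exists_abs_sub_rpow_le hp hε
  refine ⟨C, hC, fun a b => ?_⟩
  simp only [Lp_norm_rpow_eq hp]
  have ia := integrable_abs_rpow hp (Lp.memLp a)
  have ib := integrable_abs_rpow hp (Lp.memLp b)
  have im := integrable_abs_rpow hp (Lp.memLp ((1 / 2 : ℝ) • a + (1 / 2 : ℝ) • b))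
  have is := integrable_abs_rpow hp (Lp.memLp (a - b))
  have i1 : Integrable (fun x => |a x| ^ p + |b x| ^ p) μ := ia.add ib
  have i2 : Integrable (fun x => (|a x| ^ p + |b x| ^ p) / 2 -
      |((1 / 2 : ℝ) • a + (1 / 2 : ℝ) • b : Lp ℝ (ENNReal.ofReal p) μ) x| ^ p) μ :=
    (i1.div_const 2).sub im
  rw [← integral_add ia ib, ← integral_const_mul, ← integral_div,
    ← integral_sub (i1.div_const 2) im, ← integral_const_mul,
    ← integral_add (i1.const_mul ε) (i2.const_mul C)]
  refine integral_mono_ae is ((i1.const_mul ε).add (i2.const_mul C)) ?_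
  filter_upwards [Lp.coeFn_sub a b, Lp.coeFn_add ((1 / 2 : ℝ) • a) ((1 / 2 : ℝ) • b),
    Lp.coeFn_smul (1 / 2 : ℝ) a, Lp.coeFn_smul (1 / 2 : ℝ) b] with x h1 h2 h3 h4
  simp only [h1, h2, h3, h4, Pi.sub_apply, Pi.add_apply, Pi.smul_apply, smul_eq_mul]
  have := h (a x) (b x)
  rwa [show (a x + b x) / 2 = 1 / 2 * a x + 1 / 2 * b x by ring] at this

/-- A minimizer of the `L^p` norm along all lines in direction `w` satisfies the Euler-Lagrange
equation tested with `w`. -/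
lemma integral_dualPow_mul_nonneg_of_min (hp : 1 < p) {a b : X → ℝ}
    (ha : MemLp a (ENNReal.ofReal p) μ) (hb : MemLp b (ENNReal.ofReal p) μ)
    (h : ∀ t : ℝ, 0 < t → ∫ x, |a x| ^ p ∂μ ≤ ∫ x, |a x + t * b x| ^ p ∂μ) :
    0 ≤ ∫ x, dualPow p (a x) * b x ∂μ := by
  have hp0 : 0 < p := by linarith
  set t : ℕ → ℝ := fun k => 1 / ((k : ℝ) + 1) with ht
  have ht0 : ∀ k, 0 < t k := fun k => by positivity
  have ht1 : ∀ k, t k ≤ 1 := fun k => by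
    rw [ht]; simp only; rw [div_le_one (by positivity)]; linarith [(Nat.cast_nonneg k : (0:ℝ) ≤ k)]
  have htt : Filter.Tendsto t Filter.atTop (𝓝 0) := tendsto_one_div_add_atTop_nhds_zero_nat
  have hab : ∀ k, MemLp (fun x => a x + t k * b x) (ENNReal.ofReal p) μ :=
    fun k => ha.add (hb.const_mul (t k))
  have habs : MemLp (fun x => |a x| + |b x|) (ENNReal.ofReal p) μ := ha.abs.add hb.abs
  have hlim : Filter.Tendsto (fun k => ∫ x, dualPow p (a x + t k * b x) * b x ∂μ) Filter.atTop
      (𝓝 (∫ x, dualPow p (a x) * b x ∂μ)) := by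
    refine tendsto_integral_of_dominated_convergence
      (fun x => (|a x| + |b x|) ^ (p - 1) * |b x|)
      (fun k => (integrable_dualPow_mul hp (hab k) hb).1) ?_ ?_ ?_
    · refine (integrable_dualPow_mul hp habs hb.abs).norm.congr
        (Filter.Eventually.of_forall fun x => ?_)
      simp only
      rw [Real.norm_eq_abs, abs_mul, abs_dualPow hp, abs_of_nonneg (a := |a x| + |b x|)
        (by positivity), Pi.abs_apply, abs_abs]
    · refine fun k => Filter.Eventually.of_forall fun x => ?_
      rw [Real.norm_eq_abs, abs_mul, abs_dualPow hp]
      refine mul_le_mul_of_nonneg_right (Real.rpow_le_rpow (abs_nonneg _) ?_ (by linarith))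
        (abs_nonneg _)
      refine (abs_add_le _ _).trans (add_le_add le_rfl ?_)
      rw [abs_mul, abs_of_pos (ht0 k)]
      exact mul_le_of_le_one_left (abs_nonneg _) (ht1 k)
    · refine Filter.Eventually.of_forall fun x => ?_
      refine Filter.Tendsto.mul_const _ ?_
      have : Filter.Tendsto (fun k => a x + t k * b x) Filter.atTop (𝓝 (a x)) := by
        simpa using (htt.mul_const (b x)).const_add (a x)
      exact ((continuous_dualPow hp).tendsto (a x)).comp this
  refine ge_of_tendsto' hlim fun k => ?_
  -- The tangent inequality is taken at the perturbed point. Minimality then makes the pairing at `a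
  -- + t b` nonnegative for each `t > 0`, and the sign passes to the limit by dominated convergence.
  have h1 : ∫ x, |a x + t k * b x| ^ p ∂μ ≤ ∫ x, |a x| ^ p ∂μ +
      p * t k * ∫ x, dualPow p (a x + t k * b x) * b x ∂μ := by
    rw [← integral_const_mul, ← integral_add (integrable_abs_rpow hp ha)
      ((integrable_dualPow_mul hp (hab k) hb).const_mul _)]
    refine integral_mono (integrable_abs_rpow hp (hab k)) ((integrable_abs_rpow hp ha).add
      ((integrable_dualPow_mul hp (hab k) hb).const_mul _)) fun x => ?_
    refine (abs_rpow_le_add_dualPow hp (a x) _).trans (le_of_eq ?_)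
    ring
  have h2 : 0 ≤ p * t k * ∫ x, dualPow p (a x + t k * b x) * b x ∂μ := by
    linarith [h (t k) (ht0 k)]
  exact nonneg_of_mul_nonneg_right h2 (mul_pos hp0 (ht0 k))

/-- Best approximation in `L^p`: the Euler-Lagrange equation has a solution in every translate of
a closed subspace. -/
theorem exists_mem_closure_integral_dualPow_eq_zero [Fact (1 ≤ ENNReal.ofReal p)]
    (hp : 1 < p)
    (V : Submodule ℝ (Lp ℝ (ENNReal.ofReal p) μ)) (f : Lp ℝ (ENNReal.ofReal p) μ) :
    ∃ v ∈ V.topologicalClosure, ∀ w ∈ V, ∫ x, dualPow p ((f + v) x) * w x ∂μ = 0 := by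
  have hp0 : 0 < p := by linarith
  set K : Set (Lp ℝ (ENNReal.ofReal p) μ) := (fun v => f + v) '' V.topologicalClosure with hK
  have hKc : IsClosed K :=
    (Homeomorph.addLeft f).isClosedMap _ V.isClosed_topologicalClosure
  have hKx : Convex ℝ K := (V.topologicalClosure.convex).translate f
  obtain ⟨_, ⟨v, hv, rfl⟩, hmin⟩ := exists_norm_le_of_uniformlyConvex hp
    (fun ε hε => Lp_uniformlyConvex hp hε) hKc hKx ⟨f + 0, 0, V.topologicalClosure.zero_mem, rfl⟩
  have key : ∀ w ∈ V, 0 ≤ ∫ x, dualPow p ((f + v) x) * w x ∂μ := by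
    intro w hw
    refine integral_dualPow_mul_nonneg_of_min hp (Lp.memLp _) (Lp.memLp _) fun t _ => ?_
    have h1 := hmin (f + (v + t • w)) ⟨_, V.topologicalClosure.add_mem hv
      (V.topologicalClosure.smul_mem t (V.le_topologicalClosure hw)), rfl⟩
    have h2 := Real.rpow_le_rpow (norm_nonneg _) h1 hp0.le
    rw [Lp_norm_rpow_eq hp, Lp_norm_rpow_eq hp, ← add_assoc] at h2
    refine h2.trans (le_of_eq (integral_congr_ae ?_))
    filter_upwards [Lp.coeFn_add (f + v) (t • w), Lp.coeFn_smul t w] with x e1 e2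
    simp only [e1, e2, Pi.add_apply, Pi.smul_apply, smul_eq_mul]
  refine ⟨v, hv, fun w hw => le_antisymm ?_ (key w hw)⟩
  have h1 := key (-w) (V.neg_mem hw)
  have h2 : ∫ x, dualPow p ((f + v) x) * (-w : Lp ℝ (ENNReal.ofReal p) μ) x ∂μ =
      -∫ x, dualPow p ((f + v) x) * w x ∂μ := by
    rw [← integral_neg]
    refine integral_congr_ae ?_
    filter_upwards [Lp.coeFn_neg w] with x e
    rw [e, Pi.neg_apply, mul_neg]
  linarith

end Pairing

variable {n : ℕ} {s p : ℝ}

/-! ### The Gagliardo energy density -/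

/-- The integrand of the Gagliardo seminorm. -/
def energyDensity (s p : ℝ) (u : Rn n → ℝ) (z : Rn n × Rn n) : ℝ :=
  |u z.1 - u z.2| ^ p / ‖z.1 - z.2‖ ^ ((n : ℝ) + s * p)

lemma energyDensity_nonneg (u : Rn n → ℝ) (z : Rn n × Rn n) : 0 ≤ energyDensity s p u z := by
  unfold energyDensity; positivity

lemma gagliardo_rpow (hp : 1 < p) (u : Rn n → ℝ) :
    gagliardo s p u ^ p = ∫⁻ z, ENNReal.ofReal (energyDensity s p u z) := by
  rw [gagliardo, ← ENNReal.rpow_mul, one_div_mul_cancel (by linarith), ENNReal.rpow_one]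
  rfl

/-- A truncation of `|z|^{-n-sp}` at the origin that makes it integrable. -/
def kernel (s p L : ℝ) (z : Rn n) : ℝ :=
  (min (L * ‖z‖) 1) ^ p / ‖z‖ ^ ((n : ℝ) + s * p)

lemma measurable_kernel (L : ℝ) : Measurable (kernel (n := n) s p L) := by
  unfold kernel; fun_prop

lemma nontrivial_Rn (hn : 1 ≤ n) : Nontrivial (Rn n) := by
  have : Nonempty (Fin n) := ⟨⟨0, hn⟩⟩
  infer_instance

lemma kernel_nonneg {L : ℝ} (hL : 0 < L) (z : Rn n) : 0 ≤ kernel s p L z := by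
  unfold kernel; positivity

/-- In polar coordinates the radial integrand is at most `L^p y^{p-sp-1}` near zero, integrable
since `s < 1`, and at most `y^{-sp-1}` at infinity, integrable since `s > 0`. -/
lemma lintegral_kernel_lt_top (hn : 1 ≤ n) (hs0 : 0 < s) (hs1 : s < 1) (hp : 1 < p) {L : ℝ}
    (hL : 0 < L) : ∫⁻ z : Rn n, ENNReal.ofReal (kernel s p L z) < ∞ := by
  have hp0 : 0 < p := by linarith
  have := nontrivial_Rn hn
  have hcast : ((n - 1 : ℕ) : ℝ) = n - 1 := by push_cast [Nat.cast_sub hn]; ring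
  suffices h : Integrable (kernel (n := n) s p L) by
    have := h.lintegral_lt_top
    exact this
  refine (integrable_fun_norm_addHaar (volume : Measure (Rn n))
    (f := fun y => (min (L * y) 1) ^ p / y ^ ((n : ℝ) + s * p))).2 ?_
  rw [finrank_euclideanSpace_fin, ← Set.Ioc_union_Ioi_eq_Ioi zero_le_one]
  have hm : Measurable fun y : ℝ =>
      y ^ (n - 1) • ((min (L * y) 1) ^ p / y ^ ((n : ℝ) + s * p)) := by fun_prop
  refine IntegrableOn.union ?_ ?_
  · have h1 : IntegrableOn (fun y : ℝ => L ^ p * y ^ (p - s * p - 1)) (Set.Ioc 0 1) := by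
      have := (intervalIntegral.intervalIntegrable_rpow' (a := 0) (b := 1)
        (show -1 < p - s * p - 1 by nlinarith)).const_mul (L ^ p)
      rwa [intervalIntegrable_iff_integrableOn_Ioc_of_le zero_le_one] at this
    refine h1.mono' hm.aestronglyMeasurable ?_
    filter_upwards [ae_restrict_mem measurableSet_Ioc] with y hy
    have hy0 := hy.1
    rw [Real.norm_of_nonneg (by positivity), smul_eq_mul, ← Real.rpow_natCast, hcast]
    calc y ^ ((n : ℝ) - 1) * (min (L * y) 1 ^ p / y ^ ((n : ℝ) + s * p))
        ≤ y ^ ((n : ℝ) - 1) * ((L * y) ^ p / y ^ ((n : ℝ) + s * p)) := by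
          gcongr; exact min_le_left _ _
      _ = L ^ p * y ^ (p - s * p - 1) := by
          rw [Real.mul_rpow hL.le hy0.le, show p - s * p - 1 = (n - 1) + p - (n + s * p) by ring,
            Real.rpow_sub hy0 ((n : ℝ) - 1 + p), Real.rpow_add hy0 ((n : ℝ) - 1) p]
          ring
  · have h1 : IntegrableOn (fun y : ℝ => y ^ (-(s * p) - 1)) (Set.Ioi 1) :=
      integrableOn_Ioi_rpow_of_lt (by nlinarith [mul_pos hs0 hp0]) one_pos
    refine h1.mono' hm.aestronglyMeasurable ?_
    filter_upwards [ae_restrict_mem measurableSet_Ioi] with y hy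
    have hy0 : 0 < y := one_pos.trans hy
    rw [Real.norm_of_nonneg (by positivity), smul_eq_mul, ← Real.rpow_natCast, hcast]
    calc y ^ ((n : ℝ) - 1) * (min (L * y) 1 ^ p / y ^ ((n : ℝ) + s * p))
        ≤ y ^ ((n : ℝ) - 1) * (1 ^ p / y ^ ((n : ℝ) + s * p)) := by
          gcongr; exact min_le_right _ _
      _ = y ^ (-(s * p) - 1) := by
          rw [Real.one_rpow, show -(s * p) - 1 = ((n : ℝ) - 1) - (n + s * p) by ring,
            Real.rpow_sub hy0 ((n : ℝ) - 1)]
          ring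

lemma lintegral_mul_sub {a g : Rn n → ℝ≥0∞} (ha : Measurable a) (hg : Measurable g) :
    ∫⁻ z : Rn n × Rn n, a z.1 * g (z.1 - z.2) = (∫⁻ x, a x) * ∫⁻ x, g x := by
  rw [Measure.volume_eq_prod, lintegral_prod _ (by fun_prop)]
  simp only
  rw [← lintegral_mul_const _ ha]
  refine lintegral_congr fun x => ?_
  rw [lintegral_const_mul _ (by fun_prop), lintegral_sub_left_eq_self g x]

lemma lintegral_mul_sub' {a g : Rn n → ℝ≥0∞} (ha : Measurable a) (hg : Measurable g) :
    ∫⁻ z : Rn n × Rn n, a z.2 * g (z.1 - z.2) = (∫⁻ x, a x) * ∫⁻ x, g x := by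
  rw [Measure.volume_eq_prod, lintegral_prod_symm _ (by fun_prop)]
  simp only
  rw [← lintegral_mul_const _ ha]
  refine lintegral_congr fun x => ?_
  rw [lintegral_const_mul _ (by fun_prop), lintegral_sub_right_eq_self g x]

/-- By Tonelli and translation invariance, the double integral of the majorant splits into a
product. Finiteness of the energy of test functions uses `a` a multiple of an indicator; the tail
bound uses `a = |φ|^p`. -/
lemma setLIntegral_energyDensity_le {u a : Rn n → ℝ} {L : ℝ}
    (ha : Measurable a) (ha0 : ∀ x, 0 ≤ a x) {S : Set (Rn n × Rn n)} (hS : MeasurableSet S)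
    (h : ∀ z ∈ S, energyDensity s p u z ≤ (a z.1 + a z.2) * kernel s p L (z.1 - z.2)) :
    ∫⁻ z in S, ENNReal.ofReal (energyDensity s p u z) ≤
      (2 * ∫⁻ x : Rn n, ENNReal.ofReal (kernel s p L x)) * ∫⁻ x, ENNReal.ofReal (a x) := by
  have hk : Measurable fun z : Rn n => ENNReal.ofReal (kernel s p L z) :=
    (measurable_kernel L).ennreal_ofReal
  calc ∫⁻ z in S, ENNReal.ofReal (energyDensity s p u z)
      ≤ ∫⁻ z in S, (ENNReal.ofReal (a z.1) * ENNReal.ofReal (kernel s p L (z.1 - z.2)) +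
          ENNReal.ofReal (a z.2) * ENNReal.ofReal (kernel s p L (z.1 - z.2))) := by
        refine setLIntegral_mono' hS fun z hz => ?_
        rw [← add_mul, ← ENNReal.ofReal_add (ha0 _) (ha0 _),
          ← ENNReal.ofReal_mul (add_nonneg (ha0 _) (ha0 _))]
        exact ENNReal.ofReal_le_ofReal (h z hz)
    _ ≤ ∫⁻ z : Rn n × Rn n, (ENNReal.ofReal (a z.1) * ENNReal.ofReal (kernel s p L (z.1 - z.2)) +
          ENNReal.ofReal (a z.2) * ENNReal.ofReal (kernel s p L (z.1 - z.2))) :=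
        setLIntegral_le_lintegral _ _
    _ = _ := by
        have hm : Measurable fun z : Rn n × Rn n =>
            ENNReal.ofReal (a z.1) * ENNReal.ofReal (kernel s p L (z.1 - z.2)) :=
          (ha.ennreal_ofReal.comp measurable_fst).mul
            (hk.comp (measurable_fst.sub measurable_snd))
        rw [lintegral_add_left hm, lintegral_mul_sub ha.ennreal_ofReal hk,
          lintegral_mul_sub' ha.ennreal_ofReal hk]
        ring

/-! ### Test functions -/

lemma IsTestFun.memSobolev (hn : 1 ≤ n) (hs0 : 0 < s) (hs1 : s < 1) (hp : 1 < p)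
    {U : Set (Rn n)} {φ : Rn n → ℝ} (hφ : IsTestFun U φ) : MemSobolev s p φ := by
  have hp0 : 0 < p := by linarith
  refine ⟨hφ.smooth.continuous.memLp_of_hasCompactSupport hφ.compact, ?_⟩
  obtain ⟨C, hC⟩ := hφ.smooth.lipschitzWith_of_hasCompactSupport hφ.compact (by simp)
  obtain ⟨B, hB⟩ := hφ.compact.exists_bound_of_continuous hφ.smooth.continuous
  have hB0 : 0 ≤ B := (norm_nonneg _).trans (hB 0)
  set M : ℝ := 2 * B + C with hM
  have hM0 : 0 ≤ M := by positivity
  have hφM : ∀ x y, |φ x - φ y| ≤ M * min (1 * ‖x - y‖) 1 := by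
    intro x y
    have h1 : |φ x - φ y| ≤ C * ‖x - y‖ := by
      simpa [dist_eq_norm, Real.norm_eq_abs] using hC.dist_le_mul x y
    have h2 : |φ x - φ y| ≤ 2 * B := by
      have := hB x
      have := hB y
      rw [Real.norm_eq_abs] at *
      linarith [abs_sub (φ x) (φ y)]
    rw [one_mul]
    rcases min_cases ‖x - y‖ 1 with ⟨h, -⟩ | ⟨h, -⟩ <;> rw [h]
    · refine h1.trans (mul_le_mul_of_nonneg_right ?_ (norm_nonneg _))
      linarith
    · have := C.coe_nonneg
      linarith
  set a : Rn n → ℝ := (tsupport φ).indicator fun _ => M ^ p with ha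
  have hms : MeasurableSet (tsupport φ) := (isClosed_tsupport φ).measurableSet
  have ha0 : ∀ x, 0 ≤ a x := fun x => Set.indicator_nonneg (fun _ _ => by positivity) x
  have hpt : ∀ z ∈ (Set.univ : Set (Rn n × Rn n)), energyDensity s p φ z ≤
      (a z.1 + a z.2) * kernel s p 1 (z.1 - z.2) := by
    intro z _
    by_cases hz : φ z.1 = φ z.2
    · have : energyDensity s p φ z = 0 := by
        simp [energyDensity, hz, Real.zero_rpow hp0.ne']
      rw [this]
      exact mul_nonneg (add_nonneg (ha0 _) (ha0 _)) (kernel_nonneg one_pos _)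
    · have h1 : M ^ p ≤ a z.1 + a z.2 := by
        by_cases h1 : z.1 ∈ tsupport φ
        · have : a z.1 = M ^ p := Set.indicator_of_mem h1 _
          linarith [ha0 z.2]
        · by_cases h2 : z.2 ∈ tsupport φ
          · have : a z.2 = M ^ p := Set.indicator_of_mem h2 _
            linarith [ha0 z.1]
          · exact absurd (by rw [image_eq_zero_of_notMem_tsupport h1,
              image_eq_zero_of_notMem_tsupport h2]) hz
      refine le_trans ?_ (mul_le_mul_of_nonneg_right h1 (kernel_nonneg one_pos _))
      rw [energyDensity, kernel, ← mul_div_assoc, ← Real.mul_rpow hM0 (by positivity)]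
      gcongr
      exact hφM _ _
  have h := setLIntegral_energyDensity_le
    ((measurable_const (a := M ^ p)).indicator hms) ha0 MeasurableSet.univ hpt
  rw [Measure.restrict_univ, ← gagliardo_rpow hp] at h
  have hfin : ∫⁻ x, ENNReal.ofReal (a x) < ∞ := by
    have : ∀ x, ENNReal.ofReal (a x) = (tsupport φ).indicator (fun _ => ENNReal.ofReal (M ^ p)) x := by
      intro x
      by_cases hx : x ∈ tsupport φ <;> simp [ha, hx]
    simp_rw [this]
    rw [lintegral_indicator_const hms]
    exact ENNReal.mul_lt_top ENNReal.ofReal_lt_top hφ.compact.measure_lt_top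
  have h2 := h.trans_lt (ENNReal.mul_lt_top (ENNReal.mul_lt_top (by simp)
    (lintegral_kernel_lt_top hn hs0 hs1 hp one_pos)) hfin)
  exact (ENNReal.rpow_lt_top_iff_of_pos hp0).1 h2

/-- The energy of a function supported in `B(x₀, r/2)` away from `B(x₀, r) × B(x₀, r)` is
controlled by its `L^p` norm. -/
lemma exists_tail_le (hn : 1 ≤ n) (hs0 : 0 < s) (hs1 : s < 1) (hp : 1 < p) {r : ℝ} (hr : 0 < r) :
    ∃ C : ℝ≥0∞, C < ∞ ∧ ∀ (x₀ : Rn n) (φ : Rn n → ℝ), Measurable φ →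
      (∀ x, x ∉ Metric.ball x₀ (r / 2) → φ x = 0) →
      ∫⁻ z in (Metric.ball x₀ r ×ˢ Metric.ball x₀ r)ᶜ, ENNReal.ofReal (energyDensity s p φ z) ≤
        C * ∫⁻ x, ENNReal.ofReal (|φ x| ^ p) := by
  have hp0 : 0 < p := by linarith
  -- With `L = 2 / r` the truncation is inactive at distances at least `r / 2`, which is the least
  -- distance from the support to the complement of the ball of radius `r`.
  refine ⟨_, ENNReal.mul_lt_top (by simp : (2 : ℝ≥0∞) < ∞)
    (lintegral_kernel_lt_top (n := n) hn hs0 hs1 hp (L := 2 / r) (by positivity)), fun x₀ φ hm hφ => ?_⟩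
  have hker : ∀ x y : Rn n, r / 2 ≤ ‖x - y‖ →
      kernel s p (2 / r) (x - y) = 1 / ‖x - y‖ ^ ((n : ℝ) + s * p) := by
    intro x y h
    have : 1 ≤ 2 / r * ‖x - y‖ := by
      rw [div_mul_eq_mul_div, le_div_iff₀ hr]; linarith
    rw [kernel, min_eq_right this, Real.one_rpow]
  have hfar : ∀ x y : Rn n, x ∉ Metric.ball x₀ r → y ∈ Metric.ball x₀ (r / 2) →
      r / 2 ≤ dist x y := by
    intro x y hx hy
    rw [Metric.mem_ball] at hx hy
    linarith [dist_triangle x y x₀]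
  refine setLIntegral_energyDensity_le (by fun_prop) (fun x => by positivity)
    (measurableSet_ball.prod measurableSet_ball).compl fun z hz => ?_
  have hk := kernel_nonneg (s := s) (p := p) (show 0 < 2 / r by positivity) (z.1 - z.2)
  have hsmall : ∀ x, x ∉ Metric.ball x₀ r → φ x = 0 := fun x hx => hφ x fun h =>
    hx (Metric.ball_subset_ball (by linarith) h)
  have hz' : z.1 ∉ Metric.ball x₀ r ∨ z.2 ∉ Metric.ball x₀ r := by
    by_contra! h
    exact hz ⟨h.1, h.2⟩
  have h01 : 0 ≤ |φ z.1| ^ p := by positivity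
  have h02 : 0 ≤ |φ z.2| ^ p := by positivity
  rcases hz' with h | h
  · refine le_trans ?_ (mul_le_mul_of_nonneg_right (le_add_of_nonneg_left h01) hk)
    rw [energyDensity, hsmall _ h, zero_sub, abs_neg]
    by_cases h2 : z.2 ∈ Metric.ball x₀ (r / 2)
    · rw [hker _ _ (by rw [← dist_eq_norm]; exact hfar _ _ h h2), mul_one_div]
    · simp [hφ _ h2, Real.zero_rpow hp0.ne']
  · refine le_trans ?_ (mul_le_mul_of_nonneg_right (le_add_of_nonneg_right h02) hk)
    rw [energyDensity, hsmall _ h, sub_zero]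
    by_cases h2 : z.1 ∈ Metric.ball x₀ (r / 2)
    · rw [hker _ _ (by rw [← dist_eq_norm, dist_comm]; exact hfar _ _ h h2), mul_one_div]
    · simp [hφ _ h2, Real.zero_rpow hp0.ne']

/-- The fractional Poincaré inequality, with the scaling of the constant. -/
lemma exists_poincare (hn : 1 ≤ n) (hs0 : 0 < s) (hp : 1 < p) :
    ∃ C : ℝ, 0 < C ∧ ∀ (c : Rn n) (R : ℝ), 0 < R → ∀ u : Rn n → ℝ,
      AEStronglyMeasurable u volume → (∀ᵐ x, x ∉ Metric.ball c R → u x = 0) →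
      ∫⁻ x, ENNReal.ofReal (|u x| ^ p) ≤
        ENNReal.ofReal (C * R ^ (s * p)) * ∫⁻ z, ENNReal.ofReal (energyDensity s p u z) := by
  have hp0 : 0 < p := by linarith
  have := nontrivial_Rn hn
  set v : ℝ := (volume (Metric.ball (0 : Rn n) 1)).toReal with hv
  have hvtop : volume (Metric.ball (0 : Rn n) 1) ≠ ∞ := measure_ball_lt_top.ne
  have hv0 : 0 < v := ENNReal.toReal_pos (Metric.measure_ball_pos _ _ one_pos).ne' hvtop
  refine ⟨5 ^ ((n : ℝ) + s * p) / v, by positivity, fun c R hR u hu hu0 => ?_⟩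
  -- The ball `B'` shifted by `3 * R` misses `B`, so `u` vanishes on it, and its points are within
  -- `5 * R` of those of `B`. The energy on `B × B'` alone therefore dominates `|B'| (5R)^{-n-sp} ∫
  -- |u|^p`, which scales as `R^{-sp}`.
  obtain ⟨e, he⟩ := exists_norm_eq (Rn n) (c := 3 * R) (by positivity)
  set B := Metric.ball c R with hB
  set B' := Metric.ball (c + e) R with hB'
  set D : ℝ := (5 * R) ^ ((n : ℝ) + s * p) with hD
  have hD0 : 0 < D := by positivity
  have hBB' : ∀ y ∈ B', y ∉ B := by
    intro y hy hy'
    rw [hB', Metric.mem_ball] at hy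
    rw [hB, Metric.mem_ball] at hy'
    have h1 : dist (c + e) c = 3 * R := by rw [dist_eq_norm, add_sub_cancel_left, he]
    linarith [dist_triangle (c + e) y c, dist_comm y (c + e)]
  have hdist : ∀ x ∈ B, ∀ y ∈ B', ‖x - y‖ ≤ 5 * R := by
    intro x hx y hy
    rw [hB', Metric.mem_ball] at hy
    rw [hB, Metric.mem_ball] at hx
    have h1 : dist c (c + e) = 3 * R := by rw [dist_eq_norm, sub_add_cancel_left, norm_neg, he]
    rw [← dist_eq_norm]
    linarith [dist_triangle x c y, dist_triangle c (c + e) y, dist_comm y (c + e)]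
  have hvol : volume B' = ENNReal.ofReal (R ^ n * v) := by
    rw [hB', Measure.addHaar_ball _ _ hR.le, finrank_euclideanSpace_fin,
      ENNReal.ofReal_mul (by positivity), hv, ENNReal.ofReal_toReal hvtop]
  have hm : AEMeasurable (fun x => ENNReal.ofReal (|u x| ^ p)) volume :=
    (((continuous_abs.rpow_const fun _ => Or.inr hp0.le :
      Continuous fun x : ℝ => |x| ^ p).comp_aestronglyMeasurable hu).aemeasurable).ennreal_ofReal
  have hset : ∫⁻ x in B, ENNReal.ofReal (|u x| ^ p) = ∫⁻ x, ENNReal.ofReal (|u x| ^ p) := by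
    rw [← lintegral_indicator measurableSet_ball]
    refine lintegral_congr_ae ?_
    filter_upwards [hu0] with x hx
    by_cases h : x ∈ B
    · rw [Set.indicator_of_mem h]
    · rw [Set.indicator_of_notMem h, hx h]
      simp [Real.zero_rpow hp0.ne']
  have key : (∫⁻ x, ENNReal.ofReal (|u x| ^ p)) * volume B' ≤
      ENNReal.ofReal D * ∫⁻ z, ENNReal.ofReal (energyDensity s p u z) := by
    have h1 : (∫⁻ x, ENNReal.ofReal (|u x| ^ p)) * volume B' =
        ∫⁻ z in B ×ˢ B', ENNReal.ofReal (|u z.1| ^ p) := by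
      rw [Measure.volume_eq_prod, ← Measure.prod_restrict, lintegral_prod _ (by
        exact hm.restrict.comp_quasiMeasurePreserving Measure.quasiMeasurePreserving_fst)]
      simp only [lintegral_const, Measure.restrict_apply_univ]
      rw [lintegral_mul_const' _ _ measure_ball_lt_top.ne, hset]
    rw [h1]
    calc ∫⁻ z in B ×ˢ B', ENNReal.ofReal (|u z.1| ^ p)
        ≤ ∫⁻ z in B ×ˢ B', ENNReal.ofReal D * ENNReal.ofReal (energyDensity s p u z) := by
          refine lintegral_mono_ae ?_
          have h2 : ∀ᵐ z : Rn n × Rn n, z.2 ∉ B → u z.2 = 0 :=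
            Measure.quasiMeasurePreserving_snd.ae hu0
          filter_upwards [ae_restrict_mem (measurableSet_ball.prod measurableSet_ball),
            ae_restrict_of_ae h2] with z hz hz2
          rw [← ENNReal.ofReal_mul hD0.le]
          refine ENNReal.ofReal_le_ofReal ?_
          have hne : z.1 ≠ z.2 := fun h => hBB' _ hz.2 (h ▸ hz.1)
          have hpos : 0 < ‖z.1 - z.2‖ := norm_pos_iff.2 (sub_ne_zero.2 hne)
          rw [energyDensity, hz2 (hBB' _ hz.2), sub_zero, ← mul_div_assoc, le_div_iff₀ (by positivity),
            mul_comm]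
          exact mul_le_mul_of_nonneg_right (Real.rpow_le_rpow hpos.le
            (hdist _ hz.1 _ hz.2) (by positivity)) (by positivity)
      _ ≤ ∫⁻ z, ENNReal.ofReal D * ENNReal.ofReal (energyDensity s p u z) :=
          setLIntegral_le_lintegral _ _
      _ = _ := lintegral_const_mul' _ _ ENNReal.ofReal_ne_top
  have hK : 5 ^ ((n : ℝ) + s * p) / v * R ^ (s * p) = D / (R ^ n * v) := by
    rw [hD, Real.mul_rpow (by norm_num) hR.le, Real.rpow_add hR, Real.rpow_natCast]
    field_simp
  have hB0 : volume B' ≠ 0 := (Metric.measure_ball_pos _ _ hR).ne'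
  rw [hK, ENNReal.ofReal_div_of_pos (by positivity), ← hvol, ← ENNReal.mul_div_right_comm,
    ENNReal.le_div_iff_mul_le (Or.inl hB0) (Or.inl measure_ball_lt_top.ne)]
  exact key

/-! ### The weighted fractional gradient -/

/-- The fractional gradient, weighted so that its `p`-th power is the energy density of the
weighted fractional `p`-Laplacian. -/
def wGrad (s p : ℝ) (σ : Rn n → Rn n → ℝ) (u : Rn n → ℝ) (z : Rn n × Rn n) : ℝ :=
  σ z.1 z.2 ^ (1 / p) / ‖z.1 - z.2‖ ^ ((n : ℝ) / p) * fracGrad s u z.1 z.2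

variable {σ : Rn n → Rn n → ℝ}

lemma weight_rpow (hp : 1 < p) {a r : ℝ} (ha : 0 ≤ a) (hr : 0 ≤ r) :
    (a ^ (1 / p) / r ^ ((n : ℝ) / p)) ^ p = a / r ^ n := by
  have hp0 : p ≠ 0 := by linarith
  rw [Real.div_rpow (by positivity) (by positivity), ← Real.rpow_mul ha, ← Real.rpow_mul hr,
    one_div_mul_cancel hp0, div_mul_cancel₀ _ hp0, Real.rpow_one, Real.rpow_natCast]

lemma dualPow_mul_mul (hp : 1 < p) {A : ℝ} (hA : 0 ≤ A) (x y : ℝ) :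
    dualPow p (A * x) * (A * y) = A ^ p * (dualPow p x * y) := by
  rcases hA.eq_or_lt with rfl | hA
  · simp [Real.zero_rpow (by linarith : p ≠ 0)]
  · unfold dualPow
    rw [abs_mul, Real.mul_rpow (abs_nonneg _) (abs_nonneg _), abs_of_pos hA]
    have : A ^ p = A ^ (p - 2) * A * A := by
      rw [mul_assoc, ← pow_two, ← Real.rpow_natCast A 2, ← Real.rpow_add hA]
      norm_num
    rw [this]
    ring

lemma abs_wGrad_rpow (hp : 1 < p) (hσ : ∀ x y, 0 ≤ σ x y) (u : Rn n → ℝ) (z : Rn n × Rn n) :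
    |wGrad s p σ u z| ^ p = σ z.1 z.2 * energyDensity s p u z := by
  have hp0 : p ≠ 0 := by linarith
  have h := hσ z.1 z.2
  rw [wGrad, abs_mul, Real.mul_rpow (abs_nonneg _) (abs_nonneg _),
    abs_of_nonneg (by positivity), weight_rpow hp h (norm_nonneg _), fracGrad, energyDensity]
  rcases (norm_nonneg (z.1 - z.2)).eq_or_lt with h0 | h0
  · have : z.1 = z.2 := sub_eq_zero.1 (norm_eq_zero.1 h0.symm)
    simp [this, Real.zero_rpow hp0]
  · rw [abs_div, abs_of_pos (Real.rpow_pos_of_pos h0 s), Real.div_rpow (abs_nonneg _) (by positivity),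
      ← Real.rpow_mul h0.le, Real.rpow_add h0, Real.rpow_natCast]
    field_simp

/-- The pairing is homogeneous of degree `(p - 1) + 1`, so the weight `σ / |x - y|^n` can be split
as a `p`-th root on each factor. The form becomes the pairing on unweighted `L^p`. -/
lemma weightedPLap_eq_integral (hp : 1 < p) (hσ : ∀ x y, 0 ≤ σ x y) (u φ : Rn n → ℝ) :
    weightedPLap s p σ u φ = ∫ z, dualPow p (wGrad s p σ u z) * wGrad s p σ φ z := by
  rw [weightedPLap, fracDiv]
  refine integral_congr_ae (Filter.Eventually.of_forall fun z => ?_)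
  have h := hσ z.1 z.2
  simp only [wGrad]
  rw [dualPow_mul_mul hp (by positivity), weight_rpow hp h (norm_nonneg _), dualPow]
  ring

lemma wGrad_add (u v : Rn n → ℝ) (z : Rn n × Rn n) :
    wGrad s p σ (fun x => u x + v x) z = wGrad s p σ u z + wGrad s p σ v z := by
  simp only [wGrad, fracGrad]; ring

lemma wGrad_sub (u v : Rn n → ℝ) (z : Rn n × Rn n) :
    wGrad s p σ (fun x => u x - v x) z = wGrad s p σ u z - wGrad s p σ v z := by
  simp only [wGrad, fracGrad]; ring

lemma wGrad_const_mul (c : ℝ) (u : Rn n → ℝ) (z : Rn n × Rn n) :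
    wGrad s p σ (fun x => c * u x) z = c * wGrad s p σ u z := by
  simp only [wGrad, fracGrad]; ring

lemma aestronglyMeasurable_wGrad
    (hσ : AEMeasurable (fun z : Rn n × Rn n => σ z.1 z.2) volume) {u : Rn n → ℝ}
    (hu : AEStronglyMeasurable u volume) : AEStronglyMeasurable (wGrad s p σ u) volume := by
  have h1 : AEMeasurable (fun z : Rn n × Rn n => u z.1) volume :=
    (hu.comp_quasiMeasurePreserving Measure.quasiMeasurePreserving_fst).aemeasurable
  have h2 : AEMeasurable (fun z : Rn n × Rn n => u z.2) volume :=
    (hu.comp_quasiMeasurePreserving Measure.quasiMeasurePreserving_snd).aemeasurable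
  have h3 : Measurable fun z : Rn n × Rn n => ‖z.1 - z.2‖ ^ ((n : ℝ) / p) := by fun_prop
  have h4 : Measurable fun z : Rn n × Rn n => ‖z.1 - z.2‖ ^ s := by fun_prop
  exact (((hσ.pow_const (1 / p)).div h3.aemeasurable).mul
    ((h1.sub h2).div h4.aemeasurable)).aestronglyMeasurable

lemma lintegral_wGrad_le (hp : 1 < p) {l : ℝ} (hl : 0 < l)
    (hσl : ∀ x y, l ≤ σ x y ∧ σ x y ≤ l⁻¹) (u : Rn n → ℝ) :
    ∫⁻ z, ENNReal.ofReal (|wGrad s p σ u z| ^ p) ≤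
      ENNReal.ofReal l⁻¹ * ∫⁻ z, ENNReal.ofReal (energyDensity s p u z) := by
  rw [← lintegral_const_mul' _ _ ENNReal.ofReal_ne_top]
  refine lintegral_mono fun z => ?_
  rw [abs_wGrad_rpow hp fun x y => hl.le.trans (hσl x y).1, ← ENNReal.ofReal_mul (by positivity)]
  exact ENNReal.ofReal_le_ofReal
    (mul_le_mul_of_nonneg_right (hσl _ _).2 (energyDensity_nonneg _ _))

lemma lintegral_energyDensity_le (hp : 1 < p) {l : ℝ} (hl : 0 < l)
    (hσl : ∀ x y, l ≤ σ x y ∧ σ x y ≤ l⁻¹) (u : Rn n → ℝ) :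
    ∫⁻ z, ENNReal.ofReal (energyDensity s p u z) ≤
      ENNReal.ofReal l⁻¹ * ∫⁻ z, ENNReal.ofReal (|wGrad s p σ u z| ^ p) := by
  rw [← lintegral_const_mul' _ _ ENNReal.ofReal_ne_top]
  refine lintegral_mono fun z => ?_
  rw [abs_wGrad_rpow hp fun x y => hl.le.trans (hσl x y).1, ← ENNReal.ofReal_mul (by positivity)]
  refine ENNReal.ofReal_le_ofReal ?_
  have h0 := energyDensity_nonneg (s := s) (p := p) u z
  calc energyDensity s p u z = l⁻¹ * (l * energyDensity s p u z) := by field_simp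
    _ ≤ _ := by
      have := (hσl z.1 z.2).1
      gcongr

lemma le_of_rpow_le_ofReal_mul (hp : 1 < p) {l : ℝ} {a b : ℝ≥0∞}
    (h : a ^ p ≤ ENNReal.ofReal l * b ^ p) : a ≤ ENNReal.ofReal l ^ (1 / p) * b := by
  have hp0 : 0 < p := by linarith
  rw [← ENNReal.rpow_le_rpow_iff hp0, ENNReal.mul_rpow_of_nonneg _ _ hp0.le, ← ENNReal.rpow_mul,
    one_div_mul_cancel hp0.ne', ENNReal.rpow_one]
  exact h

lemma eLpNorm_wGrad_le (hp : 1 < p) {l : ℝ} (hl : 0 < l)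
    (hσl : ∀ x y, l ≤ σ x y ∧ σ x y ≤ l⁻¹) (u : Rn n → ℝ) :
    eLpNorm (wGrad s p σ u) (ENNReal.ofReal p) volume ≤
      ENNReal.ofReal l⁻¹ ^ (1 / p) * gagliardo s p u := by
  refine le_of_rpow_le_ofReal_mul hp ?_
  rw [eLpNorm_rpow_eq hp, gagliardo_rpow hp]
  exact lintegral_wGrad_le hp hl hσl u

lemma gagliardo_le (hp : 1 < p) {l : ℝ} (hl : 0 < l)
    (hσl : ∀ x y, l ≤ σ x y ∧ σ x y ≤ l⁻¹) (u : Rn n → ℝ) :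
    gagliardo s p u ≤
      ENNReal.ofReal l⁻¹ ^ (1 / p) * eLpNorm (wGrad s p σ u) (ENNReal.ofReal p) volume := by
  refine le_of_rpow_le_ofReal_mul hp ?_
  rw [eLpNorm_rpow_eq hp, gagliardo_rpow hp]
  exact lintegral_energyDensity_le hp hl hσl u

lemma ofReal_rpow_lt_top (hp : 1 < p) (l : ℝ) : ENNReal.ofReal l ^ (1 / p) < ∞ :=
  ENNReal.rpow_lt_top_of_nonneg (by have : 0 < p := by linarith
                                    positivity) ENNReal.ofReal_ne_top

lemma MemSobolev.memLp_wGrad (hp : 1 < p)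
    (hσ : AEMeasurable (fun z : Rn n × Rn n => σ z.1 z.2) volume) {l : ℝ} (hl : 0 < l)
    (hσl : ∀ x y, l ≤ σ x y ∧ σ x y ≤ l⁻¹) {u : Rn n → ℝ} (hu : MemSobolev s p u) :
    MemLp (wGrad s p σ u) (ENNReal.ofReal p) volume :=
  ⟨aestronglyMeasurable_wGrad hσ hu.memLp.1, (eLpNorm_wGrad_le hp hl hσl u).trans_lt
    (ENNReal.mul_lt_top (ofReal_rpow_lt_top hp _) hu.gagliardo_lt_top)⟩

lemma MemSobolev.of_memLp_wGrad (hp : 1 < p) {l : ℝ} (hl : 0 < l)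
    (hσl : ∀ x y, l ≤ σ x y ∧ σ x y ≤ l⁻¹) {u : Rn n → ℝ} (hu : MemLp u (ENNReal.ofReal p) volume)
    (h : MemLp (wGrad s p σ u) (ENNReal.ofReal p) volume) : MemSobolev s p u :=
  ⟨hu, (gagliardo_le hp hl hσl u).trans_lt (ENNReal.mul_lt_top (ofReal_rpow_lt_top hp _) h.2)⟩

/-! ### The closure of the test functions -/

lemma eLpNorm_le_sobolevNorm (hp : 1 < p) (u : Rn n → ℝ) :
    eLpNorm u (ENNReal.ofReal p) volume ≤ sobolevNorm s p u := by
  have hp0 : 0 < p := by linarith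
  rw [sobolevNorm, one_div, ENNReal.le_rpow_inv_iff hp0]
  exact le_self_add

lemma gagliardo_le_sobolevNorm (hp : 1 < p) (u : Rn n → ℝ) :
    gagliardo s p u ≤ sobolevNorm s p u := by
  have hp0 : 0 < p := by linarith
  rw [sobolevNorm, one_div, ENNReal.le_rpow_inv_iff hp0]
  exact le_add_self

lemma sobolevNorm_le_add (hp : 1 < p) (u : Rn n → ℝ) :
    sobolevNorm s p u ≤ eLpNorm u (ENNReal.ofReal p) volume + gagliardo s p u :=
  ENNReal.rpow_add_rpow_le_add _ _ hp.le

/-- Approximating test functions vanish off `Ω`, so the `L^p` norm of `u` there is below every `ε`.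
-/
lemma MemSobolevTilde.ae_eq_zero (hp : 1 < p) {Ω : Set (Rn n)} (hΩ : IsOpen Ω) {u : Rn n → ℝ}
    (hu : MemSobolevTilde s p Ω u) : ∀ᵐ x, x ∉ Ω → u x = 0 := by
  have hp0 : 0 < p := by linarith
  have hm : MeasurableSet Ωᶜ := hΩ.measurableSet.compl
  have h0 : eLpNorm u (ENNReal.ofReal p) (volume.restrict Ωᶜ) = 0 := by
    refine nonpos_iff_eq_zero.1 (le_of_forall_pos_le_add fun ε hε => ?_)
    rw [zero_add]
    obtain ⟨φ, hφ, h⟩ := hu.approx ε hε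
    calc eLpNorm u (ENNReal.ofReal p) (volume.restrict Ωᶜ)
        = eLpNorm (fun x => u x - φ x) (ENNReal.ofReal p) (volume.restrict Ωᶜ) := by
          refine eLpNorm_congr_ae ?_
          filter_upwards [ae_restrict_mem hm] with x hx
          rw [image_eq_zero_of_notMem_tsupport fun h => hx (hφ.support h), sub_zero]
      _ ≤ eLpNorm (fun x => u x - φ x) (ENNReal.ofReal p) volume :=
          eLpNorm_mono_measure _ Measure.restrict_le_self
      _ ≤ ε := (eLpNorm_le_sobolevNorm hp _).trans h.le
  rw [eLpNorm_eq_zero_iff hu.memSobolev.memLp.1.restrict (by simpa using hp0)] at h0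
  exact (ae_restrict_iff' hm).1 h0

lemma isTestFun_zero (U : Set (Rn n)) : IsTestFun U fun _ => 0 := by
  refine ⟨contDiff_const, HasCompactSupport.zero, ?_⟩
  have : tsupport (fun _ : Rn n => (0 : ℝ)) = ∅ := by simp
  simp [this]

lemma IsTestFun.add {U : Set (Rn n)} {φ ψ : Rn n → ℝ} (hφ : IsTestFun U φ) (hψ : IsTestFun U ψ) :
    IsTestFun U fun x => φ x + ψ x :=
  ⟨hφ.smooth.add hψ.smooth, hφ.compact.add hψ.compact,
    (tsupport_add φ ψ).trans (Set.union_subset hφ.support hψ.support)⟩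

lemma IsTestFun.const_mul {U : Set (Rn n)} {φ : Rn n → ℝ} (hφ : IsTestFun U φ) (c : ℝ) :
    IsTestFun U fun x => c * φ x :=
  ⟨contDiff_const.mul hφ.smooth, hφ.compact.mul_left,
    (tsupport_mul_subset_right (f := fun _ => c)).trans hφ.support⟩

lemma IsTestFun.sub {U : Set (Rn n)} {φ ψ : Rn n → ℝ} (hφ : IsTestFun U φ) (hψ : IsTestFun U ψ) :
    IsTestFun U fun x => φ x - ψ x := by
  have := hφ.add (hψ.const_mul (-1))
  simpa only [neg_one_mul, ← sub_eq_add_neg] using this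

/-- The Poincaré inequality in terms of the weighted gradient. -/
lemma exists_eLpNorm_le_wGrad (hn : 1 ≤ n) (hs0 : 0 < s) (hp : 1 < p) {l : ℝ} (hl : 0 < l)
    (hσl : ∀ x y, l ≤ σ x y ∧ σ x y ≤ l⁻¹) {Ω : Set (Rn n)} (hΩ : Bornology.IsBounded Ω) :
    ∃ K : ℝ, 0 ≤ K ∧ ∀ φ : Rn n → ℝ, IsTestFun Ω φ →
      eLpNorm φ (ENNReal.ofReal p) volume ≤
        ENNReal.ofReal K * eLpNorm (wGrad s p σ φ) (ENNReal.ofReal p) volume := by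
  have hp0 : 0 < p := by linarith
  obtain ⟨C, hC, h⟩ := exists_poincare (s := s) hn hs0 hp
  obtain ⟨R, hR, hΩR⟩ := hΩ.subset_ball_lt 0 (0 : Rn n)
  refine ⟨(C * R ^ (s * p) * l⁻¹) ^ (1 / p), by positivity, fun φ hφ => ?_⟩
  rw [← ENNReal.ofReal_rpow_of_nonneg (by positivity) (by positivity)]
  refine le_of_rpow_le_ofReal_mul hp ?_
  rw [eLpNorm_rpow_eq hp, eLpNorm_rpow_eq hp, ENNReal.ofReal_mul (by positivity), mul_assoc]
  refine (h 0 R hR φ hφ.smooth.continuous.aestronglyMeasurable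
    (Filter.Eventually.of_forall fun x hx => ?_)).trans
    (mul_le_mul_right (lintegral_energyDensity_le hp hl hσl φ) _)
  exact image_eq_zero_of_notMem_tsupport fun h => hx (hΩR (hφ.support h))

/-! ### Weak solutions -/

/-- The weighted gradients of test functions as a subspace of `L^p`. -/
def testGradients (s p : ℝ) (σ : Rn n → Rn n → ℝ) (Ω : Set (Rn n)) :
    Submodule ℝ (Lp ℝ (ENNReal.ofReal p) (volume : Measure (Rn n × Rn n))) where
  carrier := {g | ∃ φ, IsTestFun Ω φ ∧ g =ᵐ[volume] wGrad s p σ φ}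
  add_mem' := by
    rintro g h ⟨φ, hφ, hg⟩ ⟨ψ, hψ, hh⟩
    refine ⟨_, hφ.add hψ, ?_⟩
    filter_upwards [Lp.coeFn_add g h, hg, hh] with z h1 h2 h3
    rw [h1, Pi.add_apply, h2, h3, wGrad_add]
  zero_mem' := by
    refine ⟨_, isTestFun_zero Ω, ?_⟩
    filter_upwards [Lp.coeFn_zero ℝ (ENNReal.ofReal p) (volume : Measure (Rn n × Rn n))] with z h
    rw [h]
    simp [wGrad, fracGrad]
  smul_mem' := by
    rintro c g ⟨φ, hφ, hg⟩
    refine ⟨_, hφ.const_mul c, ?_⟩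
    filter_upwards [Lp.coeFn_smul c g, hg] with z h1 h2
    rw [h1, Pi.smul_apply, h2, wGrad_const_mul, smul_eq_mul]

/-- Limits of weighted gradients of test functions are weighted gradients. -/
lemma exists_memSobolevTilde_of_mem_closure (hn : 1 ≤ n) (hs0 : 0 < s) (hs1 : s < 1) (hp : 1 < p)
    {l : ℝ} (hl : 0 < l)
    (hσl : ∀ x y, l ≤ σ x y ∧ σ x y ≤ l⁻¹) {Ω : Set (Rn n)} (hΩ : Bornology.IsBounded Ω)
    [Fact (1 ≤ ENNReal.ofReal p)]
    {v : Lp ℝ (ENNReal.ofReal p) (volume : Measure (Rn n × Rn n))}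
    (hv : v ∈ (testGradients s p σ Ω).topologicalClosure) :
    ∃ w : Rn n → ℝ, MemSobolevTilde s p Ω w ∧ v =ᵐ[volume] wGrad s p σ w := by
  obtain ⟨K, hK, hpoin⟩ := exists_eLpNorm_le_wGrad (s := s) hn hs0 hp hl hσl hΩ
  obtain ⟨g, hg, hgv⟩ := mem_closure_iff_seq_limit.1 hv
  choose φ hφ hgφ using hg
  have hφLp : ∀ k, MemLp (φ k) (ENNReal.ofReal p) volume :=
    fun k => ((hφ k).memSobolev hn hs0 hs1 hp).memLp
  set h : ℕ → Lp ℝ (ENNReal.ofReal p) (volume : Measure (Rn n)) := fun k => (hφLp k).toLp with hh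
  -- Poincaré turns convergence of the gradients into convergence of the functions in `L^p`.
  have hdist : ∀ k m, dist (h k) (h m) ≤ K * dist (g k) (g m) := by
    intro k m
    have h1 := hpoin _ ((hφ k).sub (hφ m))
    have h2 : eLpNorm (wGrad s p σ fun x => φ k x - φ m x) (ENNReal.ofReal p) volume =
        eLpNorm (fun z => g k z - g m z) (ENNReal.ofReal p) volume := by
      refine eLpNorm_congr_ae ?_
      filter_upwards [hgφ k, hgφ m] with z h1 h2
      rw [wGrad_sub, h1, h2]
    rw [h2] at h1
    rw [Lp.dist_def, Lp.dist_def, ← ENNReal.toReal_ofReal hK, ← ENNReal.toReal_mul]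
    refine ENNReal.toReal_mono (ENNReal.mul_ne_top ENNReal.ofReal_ne_top
      ((Lp.memLp (g k)).sub (Lp.memLp (g m))).2.ne) (le_trans (le_of_eq ?_) h1)
    refine eLpNorm_congr_ae ?_
    filter_upwards [(hφLp k).coeFn_toLp, (hφLp m).coeFn_toLp] with x e1 e2
    rw [Pi.sub_apply, e1, e2]
  have hC : CauchySeq h := by
    rw [Metric.cauchySeq_iff]
    intro ε hε
    obtain ⟨N, hN⟩ := Metric.cauchySeq_iff.1 hgv.cauchySeq (ε / (K + 1)) (by positivity)
    refine ⟨N, fun k hk m hm => (hdist k m).trans_lt ?_⟩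
    calc K * dist (g k) (g m) ≤ K * (ε / (K + 1)) := by gcongr; exact (hN k hk m hm).le
      _ < (K + 1) * (ε / (K + 1)) := by gcongr; linarith
      _ = ε := by field_simp
  obtain ⟨w, hw⟩ := cauchySeq_tendsto_of_complete hC
  -- Along a common subsequence both the functions and their gradients converge almost everywhere.
  -- As `wGrad` is a pointwise expression in the function, this identifies `v` as the gradient of
  -- `w`.
  obtain ⟨ns, hns, hnsw⟩ := (tendstoInMeasure_of_tendsto_Lp hw).exists_seq_tendsto_ae
  obtain ⟨ms, hms, hmsv⟩ :=
    (tendstoInMeasure_of_tendsto_Lp (hgv.comp hns.tendsto_atTop)).exists_seq_tendsto_ae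
  have hφw : ∀ᵐ x, Filter.Tendsto (fun i => φ (ns (ms i)) x) Filter.atTop (𝓝 (w x)) := by
    filter_upwards [hnsw, ae_all_iff.2 fun k => (hφLp k).coeFn_toLp] with x h1 h2
    have := h1.comp hms.tendsto_atTop
    simpa only [hh, Function.comp_def, h2] using this
  have hvw : v =ᵐ[volume] wGrad s p σ w := by
    have h1 : ∀ᵐ z : Rn n × Rn n, Filter.Tendsto (fun i => φ (ns (ms i)) z.1) Filter.atTop
      (𝓝 (w z.1)) := Measure.quasiMeasurePreserving_fst.ae hφw
    have h2 : ∀ᵐ z : Rn n × Rn n, Filter.Tendsto (fun i => φ (ns (ms i)) z.2) Filter.atTop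
      (𝓝 (w z.2)) := Measure.quasiMeasurePreserving_snd.ae hφw
    filter_upwards [h1, h2, hmsv, ae_all_iff.2 hgφ] with z h1 h2 h3 h4
    refine tendsto_nhds_unique h3 ?_
    simp only [Function.comp_apply, h4]
    exact ((h1.sub h2).div_const _).const_mul _
  have hwLp : MemLp (w : Rn n → ℝ) (ENNReal.ofReal p) volume := Lp.memLp w
  refine ⟨w, ⟨.of_memLp_wGrad hp hl hσl hwLp ((memLp_congr_ae hvw).1 (Lp.memLp v)),
    fun ε hε => ?_⟩, hvw⟩
  have e1 : Filter.Tendsto (fun k => eLpNorm (fun x => w x - φ k x) (ENNReal.ofReal p) volume)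
      Filter.atTop (𝓝 0) := by
    refine ((Lp.tendsto_Lp_iff_tendsto_eLpNorm' h w).1 hw).congr fun k => ?_
    rw [eLpNorm_sub_comm]
    refine eLpNorm_congr_ae ?_
    filter_upwards [(hφLp k).coeFn_toLp] with x e
    rw [Pi.sub_apply, e]
  have e2 : Filter.Tendsto (fun k => ENNReal.ofReal l⁻¹ ^ (1 / p) *
      eLpNorm (wGrad s p σ fun x => w x - φ k x) (ENNReal.ofReal p) volume)
      Filter.atTop (𝓝 0) := by
    rw [← mul_zero (ENNReal.ofReal l⁻¹ ^ (1 / p))]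
    refine ENNReal.Tendsto.const_mul ?_ (Or.inr (ofReal_rpow_lt_top hp _).ne)
    refine ((Lp.tendsto_Lp_iff_tendsto_eLpNorm' g v).1 hgv).congr fun k => ?_
    rw [eLpNorm_sub_comm]
    refine eLpNorm_congr_ae ?_
    filter_upwards [hgφ k, hvw] with z e e'
    rw [Pi.sub_apply, e, e', wGrad_sub]
  have e3 := e1.add e2
  rw [add_zero] at e3
  obtain ⟨k, hk⟩ := (e3.eventually (gt_mem_nhds hε)).exists
  exact ⟨φ k, hφ k, ((sobolevNorm_le_add hp _).trans
    (add_le_add le_rfl (gagliardo_le hp hl hσl _))).trans_lt hk⟩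

/-- Existence of weak solutions. -/
theorem exists_isWeakSolution (hn : 1 ≤ n) (hs0 : 0 < s) (hs1 : s < 1) (hp : 1 < p)
    (hσ : AEMeasurable (fun z : Rn n × Rn n => σ z.1 z.2) volume)
    (hσl : UniformlyElliptic σ) {Ω : Set (Rn n)} (hΩ : Bornology.IsBounded Ω) {f : Rn n → ℝ}
    (hf : MemSobolev s p f) : ∃ u, IsWeakSolution s p Ω σ f u := by
  obtain ⟨l, hl, hσl⟩ := hσl
  have : Fact (1 ≤ ENNReal.ofReal p) := ⟨by simpa using hp.le⟩
  have hfG := hf.memLp_wGrad hp hσ hl hσl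
  obtain ⟨v, hv, hEL⟩ := exists_mem_closure_integral_dualPow_eq_zero hp (testGradients s p σ Ω)
    hfG.toLp
  obtain ⟨w, hw, hvw⟩ := exists_memSobolevTilde_of_mem_closure hn hs0 hs1 hp hl hσl hΩ hv
  have hwG := hw.memSobolev.memLp_wGrad hp hσ hl hσl
  have hG : wGrad s p σ (fun x => f x + w x) = wGrad s p σ f + wGrad s p σ w :=
    funext fun z => wGrad_add f w z
  refine ⟨fun x => f x + w x, .of_memLp_wGrad hp hl hσl (hf.memLp.add hw.memSobolev.memLp)
    (hG ▸ hfG.add hwG), fun φ hφ => ?_, by simpa only [add_sub_cancel_left] using hw⟩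
  have hφG := (hφ.memSobolev hn hs0 hs1 hp).memLp_wGrad hp hσ hl hσl
  have h1 := hEL hφG.toLp ⟨φ, hφ, hφG.coeFn_toLp⟩
  rw [weightedPLap_eq_integral hp fun x y => hl.le.trans (hσl x y).1, ← h1]
  refine integral_congr_ae ?_
  filter_upwards [hφG.coeFn_toLp, hfG.coeFn_toLp, hvw, Lp.coeFn_add hfG.toLp v] with z e1 e2 e3 e4
  rw [e1, e4, Pi.add_apply, e2, e3, wGrad_add]

/-- The weak equation extends to test functions in the closure. -/
lemma IsWeakSolution.integral_eq_zero (hn : 1 ≤ n) (hs0 : 0 < s) (hs1 : s < 1) (hp : 1 < p)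
    (hσ : AEMeasurable (fun z : Rn n × Rn n => σ z.1 z.2) volume) {l : ℝ} (hl : 0 < l)
    (hσl : ∀ x y, l ≤ σ x y ∧ σ x y ≤ l⁻¹) {Ω : Set (Rn n)} {f u w : Rn n → ℝ}
    (hu : IsWeakSolution s p Ω σ f u) (hw : MemSobolevTilde s p Ω w) :
    ∫ z, dualPow p (wGrad s p σ u z) * wGrad s p σ w z = 0 := by
  have hp0 : 0 < p := by linarith
  have hwG := hw.memSobolev.memLp_wGrad hp hσ hl hσl
  refine integral_dualPow_mul_eq_zero_of_approx hp (hu.memSobolev.memLp_wGrad hp hσ hl hσl) hwG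
    fun ε hε => ?_
  -- The factor `l` cancels the `l⁻¹` lost in passing from the Gagliardo energy to the weighted one.
  obtain ⟨φ, hφ, h⟩ := hw.approx (ENNReal.ofReal (l * ε) ^ (1 / p))
    (ENNReal.rpow_pos (by simp; positivity) ENNReal.ofReal_ne_top)
  have hφG := (hφ.memSobolev hn hs0 hs1 hp).memLp_wGrad hp hσ hl hσl
  refine ⟨wGrad s p σ φ, hφG, ?_, ?_⟩
  · rw [← weightedPLap_eq_integral hp fun x y => hl.le.trans (hσl x y).1]
    exact hu.equation φ hφ
  · have hd : MemLp (wGrad s p σ fun x => w x - φ x) (ENNReal.ofReal p) volume := by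
      rw [show (wGrad s p σ fun x => w x - φ x) = wGrad s p σ w - wGrad s p σ φ from
        funext fun z => wGrad_sub w φ z]
      exact hwG.sub hφG
    simp_rw [← wGrad_sub]
    rw [integral_eq_lintegral_of_nonneg_ae (Filter.Eventually.of_forall fun z => by positivity)
      (integrable_abs_rpow hp hd).1]
    refine ENNReal.toReal_le_of_le_ofReal hε.le ?_
    refine (lintegral_wGrad_le hp hl hσl _).trans ?_
    have h1 : gagliardo s p (fun x => w x - φ x) ^ p ≤ ENNReal.ofReal (l * ε) := by
      rw [← ENNReal.le_rpow_inv_iff hp0, ← one_div]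
      exact (gagliardo_le_sobolevNorm hp _).trans h.le
    rw [gagliardo_rpow hp] at h1
    refine (mul_le_mul_right h1 _).trans (le_of_eq ?_)
    rw [← ENNReal.ofReal_mul (by positivity)]
    congr 1
    field_simp

/-! ### The Dirichlet-to-Neumann map on concentrated data -/

lemma integrable_energyDensity (hp : 1 < p) {u : Rn n → ℝ} (hu : MemSobolev s p u) :
    Integrable (energyDensity s p u) := by
  have h := integrable_abs_rpow hp (hu.memLp_wGrad (σ := fun _ _ => 1) hp aemeasurable_const
    one_pos fun _ _ => by simp)
  refine h.congr (Filter.Eventually.of_forall fun z => ?_)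
  simp only
  rw [abs_wGrad_rpow hp fun _ _ => zero_le_one, one_mul]

lemma solution_spec {Ω : Set (Rn n)} {f : Rn n → ℝ} (h : ∃ u, IsWeakSolution s p Ω σ f u) :
    IsWeakSolution s p Ω σ f (solution s p Ω σ f) := by
  rw [solution, dif_pos h]
  exact h.choose_spec

/-- Write `E` for the weighted energy. Testing with `u - f` gives `⟨Λf, f⟩ = E(u)`. The lower bound
holds because `u = f` almost everywhere on `B` and the energy density is nonnegative. For the upper
bound, Young's inequality gives `E(u) ≤ (1 - 1/p) E(u) + (1/p) E(f)`, and the first term is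
absorbed. -/
lemma dnMap_self_bounds (hn : 1 ≤ n) (hs0 : 0 < s) (hs1 : s < 1) (hp : 1 < p)
    (hσ : AEMeasurable (fun z : Rn n × Rn n => σ z.1 z.2) volume)
    (hσl : UniformlyElliptic σ) {Ω : Set (Rn n)} (hΩ : IsOpen Ω) (hΩb : Bornology.IsBounded Ω)
    {f : Rn n → ℝ} (hf : MemSobolev s p f) {B : Set (Rn n)} (hB : MeasurableSet B)
    (hBΩ : Disjoint B Ω) :
    Integrable (fun z => σ z.1 z.2 * energyDensity s p f z) ∧
    ∫ z in B ×ˢ B, σ z.1 z.2 * energyDensity s p f z ≤ dnMap s p Ω σ f f ∧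
    dnMap s p Ω σ f f ≤ ∫ z, σ z.1 z.2 * energyDensity s p f z := by
  have hp0 : 0 < p := by linarith
  have hu := solution_spec (exists_isWeakSolution hn hs0 hs1 hp hσ hσl hΩb hf)
  obtain ⟨l, hl, hσl⟩ := hσl
  have hσ0 : ∀ x y, 0 ≤ σ x y := fun x y => hl.le.trans (hσl x y).1
  set u := solution s p Ω σ f with hudef
  have huG := hu.memSobolev.memLp_wGrad hp hσ hl hσl
  have hfG := hf.memLp_wGrad hp hσ hl hσl
  have hw0 := hu.integral_eq_zero hn hs0 hs1 hp hσ hl hσl hu.exterior_data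
  have hid : dnMap s p Ω σ f f = ∫ z, |wGrad s p σ u z| ^ p := by
    rw [dnMap, weightedPLap_eq_integral hp hσ0, ← hudef]
    simp only [wGrad_sub, mul_sub] at hw0
    rw [integral_sub (integrable_dualPow_mul hp huG huG) (integrable_dualPow_mul hp huG hfG)] at hw0
    simp only [dualPow_mul_self hp] at hw0
    linarith
  simp only [← abs_wGrad_rpow hp hσ0]
  have iu := integrable_abs_rpow hp huG
  refine ⟨integrable_abs_rpow hp hfG, ?_, ?_⟩
  · have huf : ∀ᵐ x, x ∈ B → u x = f x := by
      filter_upwards [hu.exterior_data.ae_eq_zero hp hΩ] with x hx hxB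
      exact sub_eq_zero.1 (hx (Set.disjoint_left.1 hBΩ hxB))
    have h1 : ∀ᵐ z : Rn n × Rn n, z.1 ∈ B → u z.1 = f z.1 :=
      Measure.quasiMeasurePreserving_fst.ae huf
    have h2 : ∀ᵐ z : Rn n × Rn n, z.2 ∈ B → u z.2 = f z.2 :=
      Measure.quasiMeasurePreserving_snd.ae huf
    have h3 : ∫ z in B ×ˢ B, |wGrad s p σ f z| ^ p = ∫ z in B ×ˢ B, |wGrad s p σ u z| ^ p := by
      refine setIntegral_congr_ae (hB.prod hB) ?_
      filter_upwards [h1, h2] with z h1 h2 hz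
      simp only [wGrad, fracGrad, h1 hz.1, h2 hz.2]
    rw [h3, hid]
    exact setIntegral_le_integral iu (Filter.Eventually.of_forall fun z => by positivity)
  · have h1 := integral_dualPow_mul_le hp huG hfG
    have h2 : ∫ z, dualPow p (wGrad s p σ u z) * wGrad s p σ f z = dnMap s p Ω σ f f := by
      rw [dnMap, weightedPLap_eq_integral hp hσ0]
    rw [h2, ← hid] at h1
    have h3 : 1 / p * dnMap s p Ω σ f f ≤ 1 / p * ∫ z, |wGrad s p σ f z| ^ p := by linarith
    exact le_of_mul_le_mul_left h3 (by positivity)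

/-- There are test functions supported in a given ball whose energy is concentrated on the square
of that ball. -/
lemma exists_concentrated (hn : 1 ≤ n) (hs0 : 0 < s) (hs1 : s < 1) (hp : 1 < p) (x₀ : Rn n)
    {r : ℝ} (hr : 0 < r) {θ : ℝ} (hθ : 0 < θ) :
    ∃ φ : Rn n → ℝ, IsTestFun (Metric.ball x₀ r) φ ∧ 0 < ∫ z, energyDensity s p φ z ∧
      ∫ z in (Metric.ball x₀ r ×ˢ Metric.ball x₀ r)ᶜ, energyDensity s p φ z ≤
        θ * ∫ z, energyDensity s p φ z := by
  have hp0 : 0 < p := by linarith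
  obtain ⟨T, hT, htail⟩ := exists_tail_le (n := n) hn hs0 hs1 hp hr
  obtain ⟨C, hC, hpoin⟩ := exists_poincare (n := n) (s := s) hn hs0 hp
  have hsp : 0 < s * p := by positivity
  -- The first entry allows the tail bound to be used; the second makes the product of the tail and
  -- Poincaré constants, `T * C * R^{sp}`, at most `θ`.
  set R : ℝ := min (r / 2) ((θ / (C * (T.toReal + 1))) ^ (1 / (s * p))) with hR
  have hT0 : 0 ≤ T.toReal := ENNReal.toReal_nonneg
  have hR0 : 0 < R := by positivity
  have hRθ : T.toReal * (C * R ^ (s * p)) ≤ θ := by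
    have h1 : R ^ (s * p) ≤ θ / (C * (T.toReal + 1)) := by
      calc R ^ (s * p) ≤ ((θ / (C * (T.toReal + 1))) ^ (1 / (s * p))) ^ (s * p) :=
            Real.rpow_le_rpow hR0.le (min_le_right _ _) hsp.le
        _ = _ := by rw [← Real.rpow_mul (by positivity), one_div_mul_cancel hsp.ne', Real.rpow_one]
    calc T.toReal * (C * R ^ (s * p))
        ≤ (T.toReal + 1) * (C * (θ / (C * (T.toReal + 1)))) := by gcongr; linarith
      _ = θ := by field_simp
  let φ : ContDiffBump x₀ := ⟨R / 4, R / 2, by positivity, by linarith⟩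
  have hφR : tsupport φ ⊆ Metric.ball x₀ R := by
    rw [φ.tsupport_eq]
    exact Metric.closedBall_subset_ball (by change R / 2 < R; linarith)
  have hRr : R ≤ r / 2 := min_le_left _ _
  have hφ : IsTestFun (Metric.ball x₀ r) φ :=
    ⟨φ.contDiff, φ.hasCompactSupport, hφR.trans (Metric.ball_subset_ball (by linarith))⟩
  have hM := hφ.memSobolev (s := s) hn hs0 hs1 hp
  have hi := integrable_energyDensity hp hM
  have hi0 := energyDensity_nonneg (s := s) (p := p) φ
  have hvan : ∀ x, x ∉ Metric.ball x₀ R → φ x = 0 := fun x hx =>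
    image_eq_zero_of_notMem_tsupport fun h => hx (hφR h)
  have h1 := hpoin x₀ R hR0 φ φ.continuous.aestronglyMeasurable
    (Filter.Eventually.of_forall hvan)
  have h2 := htail x₀ φ φ.continuous.measurable fun x hx => hvan x fun h =>
    hx (Metric.ball_subset_ball hRr h)
  have hE : ∫⁻ z, ENNReal.ofReal (energyDensity s p φ z) =
      ENNReal.ofReal (∫ z, energyDensity s p φ z) :=
    (ofReal_integral_eq_lintegral_ofReal hi (Filter.Eventually.of_forall hi0)).symm
  have hE' : ∫⁻ z in (Metric.ball x₀ r ×ˢ Metric.ball x₀ r)ᶜ,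
      ENNReal.ofReal (energyDensity s p φ z) = ENNReal.ofReal
        (∫ z in (Metric.ball x₀ r ×ˢ Metric.ball x₀ r)ᶜ, energyDensity s p φ z) :=
    (ofReal_integral_eq_lintegral_ofReal hi.restrict (Filter.Eventually.of_forall hi0)).symm
  refine ⟨φ, hφ, ?_, ?_⟩
  -- Zero energy would force `φ = 0` almost everywhere by Poincaré, hence everywhere by continuity,
  -- whereas `φ x₀ = 1`.
  · by_contra hneg
    rw [hE, ENNReal.ofReal_of_nonpos (not_lt.1 hneg), mul_zero, nonpos_iff_eq_zero,
      lintegral_eq_zero_iff (by have := φ.continuous.measurable; fun_prop)] at h1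
    have h3 : (φ : Rn n → ℝ) =ᵐ[volume] fun _ => (0 : ℝ) := by
      filter_upwards [h1] with x hx
      by_contra h0
      have : 0 < |φ x| ^ p := Real.rpow_pos_of_pos (abs_pos.2 h0) p
      simp only [Pi.zero_apply, ENNReal.ofReal_eq_zero] at hx
      linarith
    have h4 := congrFun ((Continuous.ae_eq_iff_eq volume φ.continuous continuous_const).1 h3) x₀
    rw [φ.one_of_mem_closedBall (Metric.mem_closedBall_self φ.rIn_pos.le)] at h4
    exact one_ne_zero h4
  · have hE0 : 0 ≤ ∫ z, energyDensity s p φ z := integral_nonneg hi0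
    rw [← ENNReal.ofReal_le_ofReal_iff (by positivity), ← hE']
    refine h2.trans ((mul_le_mul_right h1 T).trans ?_)
    rw [hE, ← ENNReal.ofReal_toReal hT.ne, ← mul_assoc, ← ENNReal.ofReal_mul hT0,
      ← ENNReal.ofReal_mul (by positivity)]
    exact ENNReal.ofReal_le_ofReal (mul_le_mul_of_nonneg_right hRθ hE0)

/-! ### Recovery of the diagonal on `W` -/

/-- Pass through `σ(x, x₀)`: equicontinuity controls the move from `y` to `x₀` uniformly in `x`, and
continuity of `σ(·, x₀)` controls the move from `x` to `x₀`. -/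
lemma AdmissibleCoeff.eventually_abs_sub_le {W : Set (Rn n)} (hσ : AdmissibleCoeff W σ)
    (hW : IsOpen W) {x₀ : Rn n} (hx₀ : x₀ ∈ W) {ε : ℝ} (hε : 0 < ε) :
    ∀ᶠ r in 𝓝[>] (0 : ℝ), ∀ x ∈ Metric.ball x₀ r, ∀ y ∈ Metric.ball x₀ r,
      |σ x y - σ x₀ x₀| ≤ ε := by
  have h1 := hσ.equicontinuous x₀ hx₀ _ (Metric.dist_mem_uniformity (half_pos hε))
  rw [hW.nhdsWithin_eq hx₀] at h1
  have h2 := ((hσ.continuousOn x₀ hx₀).continuousAt (hW.mem_nhds hx₀)).eventually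
    (Metric.ball_mem_nhds _ (half_pos hε))
  obtain ⟨δ, hδ, h⟩ := Metric.eventually_nhds_iff_ball.1 (h1.and h2)
  filter_upwards [Ioo_mem_nhdsGT hδ] with r hr x hx y hy
  have hx' := (h x (Metric.ball_subset_ball hr.2.le hx)).2
  have hy' := (h y (Metric.ball_subset_ball hr.2.le hy)).1 x
  simp only [Real.dist_eq] at hx'
  have hy'' : |σ x x₀ - σ x y| < ε / 2 := hy'
  rw [abs_sub_comm] at hy''
  calc |σ x y - σ x₀ x₀| = |(σ x y - σ x x₀) + (σ x x₀ - σ x₀ x₀)| := by congr 1; ring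
    _ ≤ |σ x y - σ x x₀| + |σ x x₀ - σ x₀ x₀| := abs_add_le _ _
    _ ≤ ε := by linarith

/-- With `m` and `t` the energies of a concentrated `φ` inside and outside `B × B`, the chain is
`(σ₁(x₀,x₀) - ε) m ≤ ⟨Λ₁φ, φ⟩ ≤ ⟨Λ₂φ, φ⟩ ≤ (σ₂(x₀,x₀) + ε) m + l⁻¹ t`. Dividing by `m` removes any
need to normalize `φ`. -/
lemma diagonal_le_of_dnMap_le (hn : 1 ≤ n) {Ω W : Set (Rn n)} (hΩ : IsOpen Ω)
    (hΩb : Bornology.IsBounded Ω) (hW : IsOpen W) (hWΩ : W ⊆ exterior Ω)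
    (hs0 : 0 < s) (hs1 : s < 1) (hp : 1 < p) {σ₁ σ₂ : Rn n → Rn n → ℝ}
    (hσ₁ : AdmissibleCoeff W σ₁) (hσ₂ : AdmissibleCoeff W σ₂)
    (hΛ : ∀ f : Rn n → ℝ, IsTestFun W f → dnMap s p Ω σ₁ f f ≤ dnMap s p Ω σ₂ f f)
    {x₀ : Rn n} (hx₀ : x₀ ∈ W) : σ₁ x₀ x₀ ≤ σ₂ x₀ x₀ := by
  refine le_of_forall_pos_le_add fun η hη => ?_
  -- One share each for the oscillation of `σ₁`, the oscillation of `σ₂`, and the tail.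
  set ε := η / 3 with hε
  have hε0 : 0 < ε := by positivity
  obtain ⟨l, hl, hσl⟩ := hσ₂.elliptic
  obtain ⟨δ, hδ, hδW⟩ := Metric.isOpen_iff.1 hW x₀ hx₀
  obtain ⟨r, h1, h2, hr⟩ := ((hσ₁.eventually_abs_sub_le hW hx₀ hε0).and
    ((hσ₂.eventually_abs_sub_le hW hx₀ hε0).and (Ioo_mem_nhdsGT hδ))).exists
  have hrW : Metric.ball x₀ r ⊆ W := (Metric.ball_subset_ball hr.2.le).trans hδW
  have hdisj : Disjoint (Metric.ball x₀ r) Ω :=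
    Set.disjoint_left.2 fun x hx hxΩ => hWΩ (hrW hx) (subset_closure hxΩ)
  obtain ⟨φ, hφ, hpos, htail⟩ := exists_concentrated (s := s) hn hs0 hs1 hp x₀ hr.1
    -- The bound `1 / 2` gives `t ≤ m`, so the total energy is at most `2 m`; the bound `ε * l / 2`
    -- then gives `t ≤ ε l m`, which absorbs the factor `l⁻¹` from the upper bound on `σ₂`.
    (show 0 < min (1 / 2) (ε * l / 2) by positivity)
  have hφW : IsTestFun W φ := ⟨hφ.smooth, hφ.compact, hφ.support.trans hrW⟩
  have hM := hφ.memSobolev (s := s) hn hs0 hs1 hp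
  have hB : MeasurableSet (Metric.ball x₀ r) := measurableSet_ball
  obtain ⟨i1, hlow, -⟩ :=
    dnMap_self_bounds hn hs0 hs1 hp hσ₁.aemeasurable hσ₁.elliptic hΩ hΩb hM hB hdisj
  obtain ⟨i2, -, hupp⟩ :=
    dnMap_self_bounds hn hs0 hs1 hp hσ₂.aemeasurable hσ₂.elliptic hΩ hΩb hM hB hdisj
  have hi := integrable_energyDensity hp hM
  set S := Metric.ball x₀ r ×ˢ Metric.ball x₀ r with hS
  have hSm : MeasurableSet S := hB.prod hB
  rw [← integral_add_compl hSm hi] at hpos htail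
  rw [← integral_add_compl hSm i2] at hupp
  set m := ∫ z in S, energyDensity s p φ z with hm
  set t := ∫ z in Sᶜ, energyDensity s p φ z with ht
  have ht0 : 0 ≤ t := integral_nonneg (energyDensity_nonneg φ)
  have e1 : (σ₁ x₀ x₀ - ε) * m ≤ ∫ z in S, σ₁ z.1 z.2 * energyDensity s p φ z := by
    rw [hm, ← integral_const_mul]
    refine setIntegral_mono_on (hi.restrict.const_mul _) i1.restrict hSm fun z hz => ?_
    refine mul_le_mul_of_nonneg_right ?_ (energyDensity_nonneg φ z)
    linarith [(abs_le.1 (h1 _ hz.1 _ hz.2)).1]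
  have e2 : ∫ z in S, σ₂ z.1 z.2 * energyDensity s p φ z ≤ (σ₂ x₀ x₀ + ε) * m := by
    rw [hm, ← integral_const_mul]
    refine setIntegral_mono_on i2.restrict (hi.restrict.const_mul _) hSm fun z hz => ?_
    refine mul_le_mul_of_nonneg_right ?_ (energyDensity_nonneg φ z)
    linarith [(abs_le.1 (h2 _ hz.1 _ hz.2)).2]
  have e3 : ∫ z in Sᶜ, σ₂ z.1 z.2 * energyDensity s p φ z ≤ l⁻¹ * t := by
    rw [ht, ← integral_const_mul]
    exact integral_mono i2.restrict (hi.restrict.const_mul _) fun z =>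
      mul_le_mul_of_nonneg_right (hσl _ _).2 (energyDensity_nonneg φ z)
  have e4 : t ≤ m := by
    have := htail.trans (mul_le_mul_of_nonneg_right (min_le_left _ _) hpos.le)
    linarith
  have e5 : t ≤ ε * l * m := by
    refine (htail.trans (mul_le_mul_of_nonneg_right (min_le_right _ _) hpos.le)).trans ?_
    have : ε * l / 2 * (m + t) ≤ ε * l / 2 * (m + m) := by gcongr
    linarith
  have hm0 : 0 < m := by linarith
  have e6 : l⁻¹ * t ≤ ε * m := by
    calc l⁻¹ * t ≤ l⁻¹ * (ε * l * m) := by gcongr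
      _ = ε * m := by field_simp
  have e7 : (σ₁ x₀ x₀ - ε) * m ≤ (σ₂ x₀ x₀ + 2 * ε) * m := by
    linarith [hΛ φ hφW]
  have e8 := le_of_mul_le_mul_right e7 hm0
  linarith

end FracPLap

end

/-! ### Analytic continuation from `W` to the whole space -/

theorem proposition1p4 (n : ℕ) (hn : 1 ≤ n) (Ω W : Set (FracPLap.Rn n))
    (hΩ : IsOpen Ω) (hΩb : Bornology.IsBounded Ω)
    (hW : IsOpen W) (hWne : W.Nonempty) (hWΩ : W ⊆ FracPLap.exterior Ω)
    (s p : ℝ) (hs0 : 0 < s) (hs1 : s < 1) (hp : 1 < p)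
    (σ₁ σ₂ : FracPLap.Rn n → FracPLap.Rn n → ℝ)
    (hσ₁ : FracPLap.AdmissibleCoeff W σ₁) (hσ₂ : FracPLap.AdmissibleCoeff W σ₂)
    (hΛ : ∀ f : FracPLap.Rn n → ℝ, FracPLap.IsTestFun W f →
      ∀ g : FracPLap.Rn n → ℝ, FracPLap.IsTestFun W g →
        FracPLap.dnMap s p Ω σ₁ f g = FracPLap.dnMap s p Ω σ₂ f g)
    (ha₁ : AnalyticOnNhd ℝ (fun x => σ₁ x x) Set.univ)
    (ha₂ : AnalyticOnNhd ℝ (fun x => σ₂ x x) Set.univ) :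
    ∀ x : FracPLap.Rn n, σ₁ x x = σ₂ x x := by
  obtain ⟨x₀, hx₀⟩ := hWne
  have hdiag : ∀ x ∈ W, σ₁ x x = σ₂ x x := fun x hx => le_antisymm
    (FracPLap.diagonal_le_of_dnMap_le hn hΩ hΩb hW hWΩ hs0 hs1 hp hσ₁ hσ₂
      (fun f hf => (hΛ f hf f hf).le) hx)
    (FracPLap.diagonal_le_of_dnMap_le hn hΩ hΩb hW hWΩ hs0 hs1 hp hσ₂ hσ₁
      (fun f hf => (hΛ f hf f hf).ge) hx)
  -- The open set `W` is a neighbourhood of `x₀`, so the two diagonals have the same germ there, and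
  -- the identity theorem applies on the connected space `ℝⁿ`.
  have h := ha₁.eqOn_of_preconnected_of_eventuallyEq ha₂ isPreconnected_univ (Set.mem_univ x₀)
    (Filter.eventually_of_mem (hW.mem_nhds hx₀) hdiag)
  exact fun x => h (Set.mem_univ x)
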